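/- Let $\gamma,\Omega,E\in\mathbb R$ with $\gamma\neq 0$, $|\Omega|>|\gamma|$, $\Omega\neq-2|\gamma|$, $E_0:=\sqrt{\Omega^2-\gamma^2}>0$ and $E\neq\pm E_0$. Let $A>0$ and $\theta\in\mathbb R$ be such that $z=Ae^{i\theta}$ solves the dimer equation $$(E-i\gamma)z-\Omega\bar z=6|z|^2\bar z+2z^3$$ and lies on one of the following branches: - (a) $\Omega>|\gamma|$; - (b) $\Omega<|\gamma|$ and $A^2\ge(|\gamma|-\Omega)/4$; - (c) $\Omega<-|\gamma|$ and $A^2\le\min\{(|\Omega|-|\gamma|)/4,\ |\Omega|/8\}$. Then there are $C_0>0$ and $\varepsilon_0>0$ such that for every $\varepsilon\in(0,\varepsilon_0)$ there is a unique $U\in\ell^2(\mathbb Z)$ with $$EU_n=\varepsilon(\bar U_{n+1}-2\bar U_n+\bar U_{n-1})+\Omega\bar U_n+i\gamma U_n+6|U_n|^2\bar U_n+2U_n^3,\qquad U_{-n}=U_n\quad(n\in\mathbb Z),$$ $$|U_0-Ae^{i\theta}|+\sup_{n\ge1}|U_n|\le C_0\varepsilon .$$ Put $V=\bar U$ (the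 breather is the pair $(U,V)$) and let $\mathcal H''_E$ be the Hessian at $(U,V)$ of $$H_E(u,v)=\sum_{n\in\mathbb Z}\Big[(|u_n|^2+|v_n|^2)^2+(u_n\bar v_n+\bar u_nv_n)^2+\Omega(|u_n|^2+|v_n|^2)-\varepsilon|u_{n+1}-u_n|^2-\varepsilon|v_{n+1}-v_n|^2+i\gamma(u_n\bar v_n-\bar u_nv_n)-E(u_n\bar v_n+\bar u_nv_n)\Big]$$ in the variables $\phi_n=(u_n,\bar u_n,v_n,\bar v_n)$. That is, $\mathcal H''_E$ is the bounded self-adjoint operator on $\ell^2(\mathbb Z;\mathbb C^4)$ given by $(\mathcal H''_E\phi)_n=\mathcal L_n\phi_n+\varepsilon(\phi_{n+1}-2\phi_n+\phi_{n-1})$ with $$\mathcal L_n=\begin{pmatrix}a_n&b_n&-E-i\gamma+2b_n&d_n\\ b_n&a_n&d_n&-E+i\gamma+2b_n\\ -E+i\gamma+2b_n&d_n&a_n&b_n\\ d_n&-E-i\gamma+2b_n&b_n&a_n\end{pmatrix},$$ where $a_n=\Omega+8|U_n|^2$, $b_n=2(U_n^2+\bar U_n^2)$, $d_n=4|U_n|^2$.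 For all these $\varepsilon$: 1. The kernel of $\mathcal H''_E$ is one-dimensional and spanned by $\sigma\Phi$, where $(\sigma\Phi)_n=(U_n,-\bar U_n,V_n,-\bar V_n)$. 2. If $|E|>E_0$, the spectral subspaces of $\mathcal H''_E$ for $(0,\infty)$ and for $(-\infty,0)$ are both infinite-dimensional. 3. If $|E|<E_0$ and $\Omega<-|\gamma|$, the spectral subspace for $(-\infty,0)$ is infinite-dimensional, and the part of the spectrum in $(0,\infty)$ consists of exactly three simple eigenvalues if $z$ is on branch (b), and of exactly one simple eigenvalue if $z$ is on branch (c). -/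

import Mathlib

open scoped ComplexConjugate

noncomputable section

namespace PTBreather

/-- The space `ℓ²(ℤ)` of square summable complex sequences. -/
abbrev Seq : Type := lp (fun _ : ℤ => ℂ) 2

/-- The space `ℓ²(ℤ)` of square summable sequences with blocks in `ℂ⁴`; it is a complex Hilbert
space with scalar product `∑ₙ ⟨xₙ, yₙ⟩`. -/
abbrev Seq4 : Type := lp (fun _ : ℤ => EuclideanSpace ℂ (Fin 4)) 2

/-- `E₀ = √(Ω² - γ²)`. -/
def E0 (γ Ω : ℝ) : ℝ := Real.sqrt (Ω ^ 2 - γ ^ 2)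

/-! ### The dimer equation and its solution branches -/

/-- The dimer equation `(E - iγ) z - Ω z̄ = 6 |z|² z̄ + 2 z³`. -/
def IsDimer (γ Ω E : ℝ) (z : ℂ) : Prop :=
  ((E : ℂ) - Complex.I * γ) * z - Ω * conj z = 6 * (‖z‖ : ℂ) ^ 2 * conj z + 2 * z ^ 3

/-- The point `z = A e^{iθ}` in polar form. -/
def polar (A θ : ℝ) : ℂ := A * Complex.exp (Complex.I * θ)

/-- Branch (a): `Ω > |γ|`, with amplitudes `A > 0`. -/
def OnBranchA (γ Ω E A θ : ℝ) : Prop :=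
  |γ| < Ω ∧ 0 < A ∧ IsDimer γ Ω E (polar A θ)

/-- Branch (b): `Ω < |γ|`, with amplitudes `A² ≥ A₊² = (|γ| - Ω) / 4`
(the end point `A = A₊` is the point `E = 0` of the branch). -/
def OnBranchB (γ Ω E A θ : ℝ) : Prop :=
  Ω < |γ| ∧ 0 < A ∧ (|γ| - Ω) / 4 ≤ A ^ 2 ∧ IsDimer γ Ω E (polar A θ)

/-- Branch (c): `Ω < -|γ|`, with amplitudes
`0 < A² ≤ A₋² = min {(|Ω| - |γ|) / 4, |Ω| / 8}`
(the end point `A = A₋` gives the points `E = 0` of the branch). -/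
def OnBranchC (γ Ω E A θ : ℝ) : Prop :=
  Ω < -|γ| ∧ 0 < A ∧ A ^ 2 ≤ min ((|Ω| - |γ|) / 4) (|Ω| / 8) ∧ IsDimer γ Ω E (polar A θ)

/-! ### Breathers -/

/-- `U ∈ ℓ²(ℤ)` solves the stationary equation
`E Uₙ = ε (Ūₙ₊₁ - 2 Ūₙ + Ūₙ₋₁) + Ω Ūₙ + i γ Uₙ + 6 |Uₙ|² Ūₙ + 2 Uₙ³` and `U₋ₙ = Uₙ`.
The breather is the pair `(U, V)` with `V = Ū`. -/
structure IsBreather (γ Ω E ε : ℝ) (U : Seq) : Prop where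
  stationary : ∀ n : ℤ, (E : ℂ) * U n =
    ε * (conj (U (n + 1)) - 2 * conj (U n) + conj (U (n - 1))) + Ω * conj (U n)
      + Complex.I * γ * U n + 6 * (‖U n‖ : ℂ) ^ 2 * conj (U n) + 2 * U n ^ 3
  symmetric : ∀ n : ℤ, U (-n) = U n

/-- The bound `|U₀ - z| + sup_{n ≥ 1} |Uₙ| ≤ C |ε|`. -/
def NearDimer (z : ℂ) (C ε : ℝ) (U : Seq) : Prop :=
  ‖U 0 - z‖ + (⨆ n : ℕ, ‖U ((n : ℤ) + 1)‖) ≤ C * |ε|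

/-! ### The combined energy function `H_E = H_{u,v} - E Q_{u,v}` -/

/-- The summand of `H_E` at a lattice node. Here `u, v` are the values at the node `n` and
`u', v'` the values at the node `n + 1`. -/
def energyDensity (γ Ω E ε : ℝ) (u v u' v' : ℂ) : ℝ :=
  (‖u‖ ^ 2 + ‖v‖ ^ 2) ^ 2 + (u * conj v + conj u * v).re ^ 2 + Ω * (‖u‖ ^ 2 + ‖v‖ ^ 2)
    - ε * ‖u' - u‖ ^ 2 - ε * ‖v' - v‖ ^ 2
    + (Complex.I * γ * (u * conj v - conj u * v)).re
    - E * (u * conj v + conj u * v).re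

/-- The combined energy function `H_E(u, v)` on `ℓ²(ℤ)`. -/
def combinedEnergy (γ Ω E ε : ℝ) (u v : Seq) : ℝ :=
  ∑' n : ℤ, energyDensity γ Ω E ε (u n) (v n) (u (n + 1)) (v (n + 1))

/-! ### The Hessian operator -/

/-- The `4 × 4` block of the Hessian at a node where the breather has `Uₙ = z`, `Vₙ = z̄`. -/
def block (γ Ω E : ℝ) (z : ℂ) : Matrix (Fin 4) (Fin 4) ℂ :=
  let a : ℂ := Ω + 8 * (‖z‖ : ℂ) ^ 2
  let b : ℂ := 2 * (z ^ 2 + conj z ^ 2)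
  let c : ℂ := 4 * (z ^ 2 + conj z ^ 2)
  let d : ℂ := 4 * (‖z‖ : ℂ) ^ 2
  let g : ℂ := Complex.I * γ
  !![a, b, -E - g + c, d;
     b, a, d, -E + g + c;
     -E + g + c, d, a, b;
     d, -E - g + c, b, a]

/-- The block as an operator on `ℂ⁴`. -/
def blockCLM (γ Ω E : ℝ) (z : ℂ) : EuclideanSpace ℂ (Fin 4) →L[ℂ] EuclideanSpace ℂ (Fin 4) :=
  Matrix.toEuclideanCLM (n := Fin 4) (𝕜 := ℂ) (block γ Ω E z)

theorem continuous_blockCLM (γ Ω E : ℝ) : Continuous (blockCLM γ Ω E) := by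
  have h1 : Continuous (block γ Ω E) := by
    refine continuous_matrix fun i j => ?_
    fin_cases i <;> fin_cases j <;> simp [block] <;> fun_prop
  have h2 : Continuous (Matrix.toEuclideanCLM (n := Fin 4) (𝕜 := ℂ)) :=
    LinearMap.continuous_of_finiteDimensional
      (Matrix.toEuclideanCLM (n := Fin 4) (𝕜 := ℂ)).toAlgEquiv.toLinearMap
  exact h2.comp h1

theorem bddAbove_blockCLM (γ Ω E : ℝ) (U : Seq) :
    BddAbove (Set.range fun n : ℤ => ‖blockCLM γ Ω E (U n)‖) := by
  have hK : IsCompact (Metric.closedBall (0 : ℂ) ‖U‖) := isCompact_closedBall _ _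
  obtain ⟨C, hC⟩ := hK.exists_bound_of_continuousOn (continuous_blockCLM γ Ω E).continuousOn
  refine ⟨C, ?_⟩
  rintro _ ⟨n, rfl⟩
  exact hC _ (by simpa using lp.norm_apply_le_norm (by norm_num) U n)

/-- The block-diagonal operator `𝓛`. -/
def blockOp (γ Ω E : ℝ) (U : Seq) : Seq4 →L[ℂ] Seq4 :=
  lp.mapCLM 2 (fun n => blockCLM γ Ω E (U n)) (K := ⨆ n : ℤ, ‖blockCLM γ Ω E (U n)‖)
    (Real.iSup_nonneg fun _ => norm_nonneg _) (fun n => le_ciSup (bddAbove_blockCLM γ Ω E U) n)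

theorem memlp_shift (k : ℤ) (φ : Seq4) :
    Memℓp (fun n : ℤ => φ (n + k)) 2 := by
  refine memℓp_gen ?_
  exact ((lp.memℓp φ).summable (by norm_num)).comp_injective (add_left_injective k)

/-- The shift `(Sₖ φ)ₙ = φₙ₊ₖ`. -/
def shift (k : ℤ) : Seq4 →L[ℂ] Seq4 :=
  LinearMap.mkContinuous
    { toFun := fun φ => ⟨fun n => φ (n + k), memlp_shift k φ⟩
      map_add' := fun _ _ => rfl
      map_smul' := fun _ _ => rfl } 1 (by
    intro φ
    rw [one_mul, lp.norm_eq_tsum_rpow (by norm_num), lp.norm_eq_tsum_rpow (by norm_num)]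
    refine le_of_eq (congrArg (fun x : ℝ => x ^ (1 / (2 : ENNReal).toReal)) ?_)
    exact (Equiv.addRight k).tsum_eq (fun n => ‖φ n‖ ^ (2 : ENNReal).toReal))

/-- The discrete Laplacian `(Δφ)ₙ = φₙ₊₁ - 2φₙ + φₙ₋₁`. -/
def laplacian : Seq4 →L[ℂ] Seq4 :=
  shift 1 - (2 : ℂ) • ContinuousLinearMap.id ℂ Seq4 + shift (-1)

/-- The Hessian operator `𝓗''_E = 𝓛 + ε Δ` of `H_E` at the breather `(U, Ū)`. -/
def hessian (γ Ω E ε : ℝ) (U : Seq) : Seq4 →L[ℂ] Seq4 :=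
  blockOp γ Ω E U + (ε : ℂ) • laplacian

theorem blockOp_apply (γ Ω E : ℝ) (U : Seq) (φ : Seq4) (n : ℤ) :
    blockOp γ Ω E U φ n = blockCLM γ Ω E (U n) (φ n) := rfl

theorem shift_apply (k : ℤ) (φ : Seq4) (n : ℤ) : shift k φ n = φ (n + k) := rfl

theorem hessian_apply (γ Ω E ε : ℝ) (U : Seq) (φ : Seq4) (n : ℤ) :
    hessian γ Ω E ε U φ n =
      blockCLM γ Ω E (U n) (φ n) + (ε : ℂ) • (φ (n + 1) - (2 : ℂ) • φ n + φ (n - 1)) := rfl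

/-- The sequence of blocks `(aₙ, bₙ, cₙ, dₙ)`. -/
def mk4 (a b c d : Seq) : Seq4 :=
  ⟨fun n => !₂[a n, b n, c n, d n], by
    refine memℓp_gen ?_
    have h : ∀ u : Seq, Summable fun n : ℤ => ‖u n‖ ^ 2 := fun u => by
      simpa using (lp.memℓp u).summable (by norm_num)
    simpa [EuclideanSpace.norm_sq_eq, Fin.sum_univ_four] using
      (((h a).add (h b)).add (h c)).add (h d)⟩

theorem mk4_apply (a b c d : Seq) (n : ℤ) : mk4 a b c d n = !₂[a n, b n, c n, d n] := rfl

/-- The extended variable `φₙ = (uₙ, ūₙ, vₙ, v̄ₙ)`. -/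
def extended (u v : Seq) : Seq4 := mk4 u (star u) v (star v)

/-- The gauge mode `(σΦ)ₙ = (Uₙ, -Ūₙ, Vₙ, -V̄ₙ)` of the breather `(U, V)`. -/
def gaugeMode (U V : Seq) : Seq4 := mk4 U (-star U) V (-star V)


/-! ### The Hessian is self-adjoint and is the second variation of `H_E` -/

theorem block_isHermitian (γ Ω E : ℝ) (z : ℂ) : (block γ Ω E z).IsHermitian := by
  ext i j
  fin_cases i <;> fin_cases j <;>
    simp [block, Matrix.conjTranspose_apply, -Complex.star_def] <;> ring

theorem blockCLM_isSelfAdjoint (γ Ω E : ℝ) (z : ℂ) : IsSelfAdjoint (blockCLM γ Ω E z) := by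
  have h : IsSelfAdjoint (block γ Ω E z) := block_isHermitian γ Ω E z
  exact h.map (Matrix.toEuclideanCLM (n := Fin 4) (𝕜 := ℂ))

theorem blockOp_isSelfAdjoint (γ Ω E : ℝ) (U : Seq) : IsSelfAdjoint (blockOp γ Ω E U) := by
  rw [ContinuousLinearMap.isSelfAdjoint_iff_isSymmetric]
  intro φ ψ
  change inner ℂ (blockOp γ Ω E U φ) ψ = inner ℂ φ (blockOp γ Ω E U ψ)
  rw [lp.inner_eq_tsum, lp.inner_eq_tsum]
  refine tsum_congr fun n => ?_
  exact (ContinuousLinearMap.isSelfAdjoint_iff_isSymmetric.1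
    (blockCLM_isSelfAdjoint γ Ω E (U n))) (φ n) (ψ n)

theorem inner_shift (k : ℤ) (φ ψ : Seq4) :
    inner ℂ (shift k φ) ψ = inner ℂ φ (shift (-k) ψ) := by
  rw [lp.inner_eq_tsum, lp.inner_eq_tsum, ← (Equiv.addRight k).tsum_eq
    (fun n => inner ℂ (φ n) (shift (-k) ψ n))]
  refine tsum_congr fun n => ?_
  simp [shift_apply]

theorem laplacian_isSelfAdjoint : IsSelfAdjoint laplacian := by
  rw [ContinuousLinearMap.isSelfAdjoint_iff_isSymmetric]
  intro φ ψ
  change inner ℂ (shift 1 φ - (2 : ℂ) • φ + shift (-1) φ) ψ =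
    inner ℂ φ (shift 1 ψ - (2 : ℂ) • ψ + shift (-1) ψ)
  have h1 := inner_shift 1 φ ψ
  have h2 := inner_shift (-1) φ ψ
  rw [neg_neg] at h2
  rw [inner_add_left, inner_sub_left, inner_add_right, inner_sub_right, h1, h2, inner_smul_left,
    inner_smul_right, Complex.conj_ofNat]
  ring

theorem hessian_isSelfAdjoint (γ Ω E ε : ℝ) (U : Seq) : IsSelfAdjoint (hessian γ Ω E ε U) := by
  refine (blockOp_isSelfAdjoint γ Ω E U).add ?_
  exact IsSelfAdjoint.smul (Complex.conj_ofReal ε) laplacian_isSelfAdjoint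

theorem summable_sq (u : Seq) : Summable fun n : ℤ => ‖u n‖ ^ 2 := by
  simpa using (lp.memℓp u).summable (by norm_num)

theorem summable_energyDensity (γ Ω E ε : ℝ) (u v : Seq) :
    Summable fun n : ℤ => energyDensity γ Ω E ε (u n) (v n) (u (n + 1)) (v (n + 1)) := by
  have hu := summable_sq u
  have hv := summable_sq v
  have hu' : Summable fun n : ℤ => ‖u (n + 1)‖ ^ 2 := hu.comp_injective (add_left_injective 1)
  have hv' : Summable fun n : ℤ => ‖v (n + 1)‖ ^ 2 := hv.comp_injective (add_left_injective 1)
  have hs := (hu.add hv)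
  have hquad : ∀ f : ℤ → ℝ, (∃ C, ∀ n, |f n| ≤ C * (‖u n‖ ^ 2 + ‖v n‖ ^ 2)) → Summable f := by
    rintro f ⟨C, hC⟩
    exact Summable.of_norm_bounded (hs.mul_left C) (fun n => by simpa using hC n)
  have hbu : ∀ n, ‖u n‖ ^ 2 ≤ ‖u‖ ^ 2 := fun n => by
    have := lp.norm_apply_le_norm (by norm_num) u n
    gcongr
  have hbv : ∀ n, ‖v n‖ ^ 2 ≤ ‖v‖ ^ 2 := fun n => by
    have := lp.norm_apply_le_norm (by norm_num) v n
    gcongr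
  have hre : ∀ n, |(u n * conj (v n) + conj (u n) * v n).re| ≤ ‖u n‖ ^ 2 + ‖v n‖ ^ 2 := by
    intro n
    refine (Complex.abs_re_le_norm _).trans ((norm_add_le _ _).trans ?_)
    simp only [norm_mul, RCLike.norm_conj]
    nlinarith [sq_nonneg (‖u n‖ - ‖v n‖)]
  have hre' : ∀ n, |(Complex.I * γ * (u n * conj (v n) - conj (u n) * v n)).re| ≤
      |γ| * (‖u n‖ ^ 2 + ‖v n‖ ^ 2) := by
    intro n
    refine (Complex.abs_re_le_norm _).trans ?_
    rw [norm_mul, norm_mul, Complex.norm_I, one_mul, Complex.norm_real, Real.norm_eq_abs]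
    refine mul_le_mul_of_nonneg_left ((norm_sub_le _ _).trans ?_) (abs_nonneg _)
    simp only [norm_mul, RCLike.norm_conj]
    nlinarith [sq_nonneg (‖u n‖ - ‖v n‖)]
  have hdiff : ∀ w : Seq, Summable fun n : ℤ => ‖w (n + 1) - w n‖ ^ 2 := by
    intro w
    have hw := summable_sq w
    have hw' : Summable fun n : ℤ => ‖w (n + 1)‖ ^ 2 := hw.comp_injective (add_left_injective 1)
    refine Summable.of_nonneg_of_le (fun n => by positivity) (fun n => ?_)
      ((hw'.add hw).mul_left 2)
    have := norm_sub_le (w (n + 1)) (w n)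
    nlinarith [norm_nonneg (w (n + 1) - w n), sq_nonneg (‖w (n + 1)‖ - ‖w n‖)]
  have h1 : Summable fun n : ℤ => (‖u n‖ ^ 2 + ‖v n‖ ^ 2) ^ 2 := by
    refine hquad _ ⟨‖u‖ ^ 2 + ‖v‖ ^ 2, fun n => ?_⟩
    rw [abs_of_nonneg (by positivity), sq]
    exact mul_le_mul_of_nonneg_right (add_le_add (hbu n) (hbv n)) (by positivity)
  have h2 : Summable fun n : ℤ => (u n * conj (v n) + conj (u n) * v n).re ^ 2 := by
    refine Summable.of_nonneg_of_le (fun n => sq_nonneg _) (fun n => ?_) h1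
    exact sq_le_sq' (abs_le.1 (hre n)).1 (abs_le.1 (hre n)).2
  have h3 := hs.mul_left Ω
  have h4 := (hdiff u).mul_left ε
  have h5 := (hdiff v).mul_left ε
  have h6 := hquad _ ⟨|γ|, hre'⟩
  have h7 := (hquad _ ⟨1, fun n => (hre n).trans (one_mul _).ge⟩).mul_left E
  exact (((((h1.add h2).add h3).sub h4).sub h5).add h6).sub h7

/-- Along a line the density is a polynomial of degree four, recovered by interpolation. -/
theorem energyDensity_interpolation (γ Ω E ε t : ℝ) (u v u' v' a b a' b' : ℂ) :
    energyDensity γ Ω E ε (u + t * a) (v + t * b) (u' + t * a') (v' + t * b') =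
      (1 - 5 / 4 * t ^ 2 + 1 / 4 * t ^ 4) * energyDensity γ Ω E ε u v u' v'
      + (2 / 3 * t + 2 / 3 * t ^ 2 - 1 / 6 * t ^ 3 - 1 / 6 * t ^ 4) *
        energyDensity γ Ω E ε (u + a) (v + b) (u' + a') (v' + b')
      + (-2 / 3 * t + 2 / 3 * t ^ 2 + 1 / 6 * t ^ 3 - 1 / 6 * t ^ 4) *
        energyDensity γ Ω E ε (u - a) (v - b) (u' - a') (v' - b')
      + (-1 / 12 * t - 1 / 24 * t ^ 2 + 1 / 12 * t ^ 3 + 1 / 24 * t ^ 4) *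
        energyDensity γ Ω E ε (u + 2 * a) (v + 2 * b) (u' + 2 * a') (v' + 2 * b')
      + (1 / 12 * t - 1 / 24 * t ^ 2 - 1 / 12 * t ^ 3 + 1 / 24 * t ^ 4) *
        energyDensity γ Ω E ε (u - 2 * a) (v - 2 * b) (u' - 2 * a') (v' - 2 * b') := by
  simp only [energyDensity, ← Complex.normSq_eq_norm_sq, Complex.normSq_apply, Complex.add_re,
    Complex.add_im, Complex.sub_re, Complex.sub_im, Complex.mul_re, Complex.mul_im,
    Complex.ofReal_re, Complex.ofReal_im, Complex.conj_re, Complex.conj_im, Complex.I_re,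
    Complex.I_im, Complex.re_ofNat, Complex.im_ofNat]
  ring

/-- The coefficient of `t ^ 2 / 2` in the density, at `v = ū`. -/
theorem energyDensity_second (γ Ω E ε : ℝ) (u u' a b a' b' : ℂ) :
    -5 / 2 * energyDensity γ Ω E ε u (conj u) u' (conj u')
      + 4 / 3 * energyDensity γ Ω E ε (u + a) (conj u + b) (u' + a') (conj u' + b')
      + 4 / 3 * energyDensity γ Ω E ε (u - a) (conj u - b) (u' - a') (conj u' - b')
      - 1 / 12 * energyDensity γ Ω E ε (u + 2 * a) (conj u + 2 * b) (u' + 2 * a')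
          (conj u' + 2 * b')
      - 1 / 12 * energyDensity γ Ω E ε (u - 2 * a) (conj u - 2 * b) (u' - 2 * a')
          (conj u' - 2 * b') =
    (inner ℂ (blockCLM γ Ω E u !₂[a, conj a, b, conj b]) !₂[a, conj a, b, conj b]).re
      - 2 * ε * ‖a' - a‖ ^ 2 - 2 * ε * ‖b' - b‖ ^ 2 := by
  have hz : (‖u‖ : ℂ) ^ 2 = (u.re * u.re + u.im * u.im : ℝ) := by
    rw [← Complex.ofReal_pow, ← Complex.normSq_eq_norm_sq, Complex.normSq_apply]
  simp only [energyDensity, ← Complex.normSq_eq_norm_sq, Complex.normSq_apply]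
  simp only [blockCLM, Matrix.toEuclideanCLM_toLp, PiLp.inner_apply, Fin.sum_univ_four, block, hz,
    Matrix.mulVec, dotProduct, RCLike.inner_apply]
  simp [pow_two, Complex.add_re, Complex.add_im, Complex.mul_re, Complex.mul_im]
  ring

/-- Along every line, `H_E` is a smooth function whose second derivative at the point `(U, Ū)` is
the quadratic form of the Hessian operator, that is,
`H_E(Φ + φ) = H_E(Φ) + H_E'(Φ) φ + ½ ⟨𝓗''_E φ, φ⟩ + …`. -/
theorem hessian_eq_second_variation (γ Ω E ε : ℝ) (U u v : Seq) :
    ContDiff ℝ 2 (fun t : ℝ => combinedEnergy γ Ω E ε (U + (t : ℂ) • u) (star U + (t : ℂ) • v)) ∧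
    iteratedDeriv 2
      (fun t : ℝ => combinedEnergy γ Ω E ε (U + (t : ℂ) • u) (star U + (t : ℂ) • v)) 0 =
    (inner ℂ (hessian γ Ω E ε U (extended u v)) (extended u v)).re := by
  set F : ℝ → ℝ := fun t => combinedEnergy γ Ω E ε (U + (t : ℂ) • u) (star U + (t : ℂ) • v) with hF
  set D : ℝ → ℤ → ℝ := fun t n => energyDensity γ Ω E ε (U n + t * u n) (conj (U n) + t * v n)
    (U (n + 1) + t * u (n + 1)) (conj (U (n + 1)) + t * v (n + 1)) with hD
  have hsum : ∀ t, Summable (D t) := fun t =>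
    summable_energyDensity γ Ω E ε (U + (t : ℂ) • u) (star U + (t : ℂ) • v)
  have hFD : ∀ t, F t = ∑' n, D t n := fun t => rfl
  have hint : ∀ t n, D t n = (1 - 5 / 4 * t ^ 2 + 1 / 4 * t ^ 4) * D 0 n
      + (2 / 3 * t + 2 / 3 * t ^ 2 - 1 / 6 * t ^ 3 - 1 / 6 * t ^ 4) * D 1 n
      + (-2 / 3 * t + 2 / 3 * t ^ 2 + 1 / 6 * t ^ 3 - 1 / 6 * t ^ 4) * D (-1) n
      + (-1 / 12 * t - 1 / 24 * t ^ 2 + 1 / 12 * t ^ 3 + 1 / 24 * t ^ 4) * D 2 n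
      + (1 / 12 * t - 1 / 24 * t ^ 2 - 1 / 12 * t ^ 3 + 1 / 24 * t ^ 4) * D (-2) n := by
    intro t n
    have := energyDensity_interpolation γ Ω E ε t (U n) (conj (U n)) (U (n + 1))
      (conj (U (n + 1))) (u n) (v n) (u (n + 1)) (v (n + 1))
    simpa [hD, sub_eq_add_neg] using this
  have hpoly : F = fun t => F 0
      + (2 / 3 * F 1 - 2 / 3 * F (-1) - 1 / 12 * F 2 + 1 / 12 * F (-2)) * t
      + (-5 / 4 * F 0 + 2 / 3 * F 1 + 2 / 3 * F (-1) - 1 / 24 * F 2 - 1 / 24 * F (-2)) * t ^ 2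
      + (-1 / 6 * F 1 + 1 / 6 * F (-1) + 1 / 12 * F 2 - 1 / 12 * F (-2)) * t ^ 3
      + (1 / 4 * F 0 - 1 / 6 * F 1 - 1 / 6 * F (-1) + 1 / 24 * F 2 + 1 / 24 * F (-2)) * t ^ 4 := by
    funext t
    have h : HasSum (D t) _ :=
      ((((((hsum 0).hasSum.mul_left (1 - 5 / 4 * t ^ 2 + 1 / 4 * t ^ 4)).add
        ((hsum 1).hasSum.mul_left (2 / 3 * t + 2 / 3 * t ^ 2 - 1 / 6 * t ^ 3 - 1 / 6 * t ^ 4))).add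
        ((hsum (-1)).hasSum.mul_left
          (-2 / 3 * t + 2 / 3 * t ^ 2 + 1 / 6 * t ^ 3 - 1 / 6 * t ^ 4))).add
        ((hsum 2).hasSum.mul_left
          (-1 / 12 * t - 1 / 24 * t ^ 2 + 1 / 12 * t ^ 3 + 1 / 24 * t ^ 4))).add
        ((hsum (-2)).hasSum.mul_left
          (1 / 12 * t - 1 / 24 * t ^ 2 - 1 / 12 * t ^ 3 + 1 / 24 * t ^ 4))).congr_fun (hint t)
    rw [hFD t, h.tsum_eq, ← hFD, ← hFD, ← hFD, ← hFD, ← hFD]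
    ring
  have hd2 : ∀ c₀ c₁ c₂ c₃ c₄ : ℝ, iteratedDeriv 2 (fun t : ℝ => c₀ + c₁ * t + c₂ * t ^ 2
      + c₃ * t ^ 3 + c₄ * t ^ 4) 0 = 2 * c₂ := by
    intro c₀ c₁ c₂ c₃ c₄
    have e1 : deriv (fun t : ℝ => c₀ + c₁ * t + c₂ * t ^ 2 + c₃ * t ^ 3 + c₄ * t ^ 4) =
        fun t => c₁ + 2 * c₂ * t + 3 * c₃ * t ^ 2 + 4 * c₄ * t ^ 3 := by
      funext t
      have := ((((hasDerivAt_const t c₀).add ((hasDerivAt_id t).const_mul c₁)).add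
        ((hasDerivAt_pow 2 t).const_mul c₂)).add ((hasDerivAt_pow 3 t).const_mul c₃)).add
        ((hasDerivAt_pow 4 t).const_mul c₄)
      refine (this.congr_deriv ?_).deriv
      norm_num
      ring
    have e2 : HasDerivAt (fun t : ℝ => c₁ + 2 * c₂ * t + 3 * c₃ * t ^ 2 + 4 * c₄ * t ^ 3)
        (2 * c₂) 0 := by
      have := (((hasDerivAt_const (0 : ℝ) c₁).add ((hasDerivAt_id (0 : ℝ)).const_mul
        (2 * c₂))).add ((hasDerivAt_pow 2 (0 : ℝ)).const_mul (3 * c₃))).add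
        ((hasDerivAt_pow 3 (0 : ℝ)).const_mul (4 * c₄))
      exact this.congr_deriv (by norm_num)
    rw [iteratedDeriv_succ, iteratedDeriv_one, e1, e2.deriv]
  refine ⟨?_, ?_⟩
  · rw [hpoly]
    fun_prop
  rw [hpoly, hd2]
  have hA : HasSum (fun n => -5 / 2 * D 0 n + 4 / 3 * D 1 n + 4 / 3 * D (-1) n - 1 / 12 * D 2 n
      - 1 / 12 * D (-2) n) (-5 / 2 * F 0 + 4 / 3 * F 1 + 4 / 3 * F (-1) - 1 / 12 * F 2
      - 1 / 12 * F (-2)) :=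
    ((((((hsum 0).hasSum.mul_left _).add ((hsum 1).hasSum.mul_left _)).add
      ((hsum (-1)).hasSum.mul_left _)).sub ((hsum 2).hasSum.mul_left _)).sub
      ((hsum (-2)).hasSum.mul_left _))
  set φ : Seq4 := extended u v with hφ
  have hB : HasSum (fun n => (inner ℂ (blockOp γ Ω E U φ n) (φ n)).re)
      (inner ℂ (blockOp γ Ω E U φ) φ).re :=
    Complex.hasSum_re (lp.hasSum_inner (𝕜 := ℂ) (blockOp γ Ω E U φ) φ)
  have hC : HasSum (fun n => ‖φ (n + 1) - φ n‖ ^ 2) (-(inner ℂ (laplacian φ) φ).re) := by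
    have h1 := Complex.hasSum_re (lp.hasSum_inner (𝕜 := ℂ) (shift 1 φ - φ) (shift 1 φ - φ))
    have h2 : (inner ℂ (shift 1 φ - φ) (shift 1 φ - φ)).re = -(inner ℂ (laplacian φ) φ).re := by
      change _ = -(inner ℂ (shift 1 φ - (2 : ℂ) • φ + shift (-1) φ) φ).re
      have e1 := inner_shift 1 φ (shift 1 φ)
      have e3 : shift (-1) (shift 1 φ) = φ := by
        ext1
        funext n
        simp [shift_apply]
      rw [e3] at e1
      have e2 := inner_shift (-1) φ φ
      rw [neg_neg] at e2
      simp only [inner_add_left, inner_sub_left, inner_sub_right, e1, inner_smul_left, e2,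
        Complex.conj_ofNat]
      simp
      ring
    rw [h2] at h1
    refine h1.congr_fun fun n => ?_
    have : (shift 1 φ - φ) n = φ (n + 1) - φ n := rfl
    rw [this]
    exact (inner_self_eq_norm_sq (𝕜 := ℂ) (φ (n + 1) - φ n)).symm
  have hBC := hB.sub (hC.mul_left ε)
  have hAB := hA.unique (hBC.congr_fun fun n => ?_)
  · have : (inner ℂ (hessian γ Ω E ε U φ) φ).re =
        (inner ℂ (blockOp γ Ω E U φ) φ).re - ε * -(inner ℂ (laplacian φ) φ).re := by
      change (inner ℂ (blockOp γ Ω E U φ + (ε : ℂ) • laplacian φ) φ).re = _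
      rw [inner_add_left, inner_smul_left, Complex.add_re, Complex.conj_ofReal,
        Complex.re_ofReal_mul]
      ring
    rw [this, ← hAB]
    ring
  · have h := energyDensity_second γ Ω E ε (U n) (U (n + 1)) (u n) (v n) (u (n + 1)) (v (n + 1))
    have hn : ‖φ (n + 1) - φ n‖ ^ 2 = 2 * ‖u (n + 1) - u n‖ ^ 2 + 2 * ‖v (n + 1) - v n‖ ^ 2 := by
      have e : φ (n + 1) - φ n = !₂[u (n + 1) - u n, conj (u (n + 1) - u n), v (n + 1) - v n,
          conj (v (n + 1) - v n)] := by
        ext i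
        fin_cases i <;> simp [hφ, extended, mk4_apply]
      rw [e, EuclideanSpace.norm_sq_eq, Fin.sum_univ_four]
      simp only [Matrix.cons_val, RCLike.norm_conj]
      ring
    have hb : blockOp γ Ω E U φ n = blockCLM γ Ω E (U n) !₂[u n, conj (u n), v n, conj (v n)] := rfl
    have hp : φ n = !₂[u n, conj (u n), v n, conj (v n)] := rfl
    rw [hn, hb, hp]
    refine Eq.trans ?_ (h.trans ?_)
    · simp [hD, sub_eq_add_neg]
    · ring

/-! ### Spectral notions for a bounded self-adjoint operator -/

section Spectral

variable {H : Type*} [NormedAddCommGroup H] [InnerProductSpace ℂ H] [CompleteSpace H]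

/-- The spectral subspace of a bounded self-adjoint `T` for `(0, ∞)`: the closure of the range of
the positive part `T⁺` (continuous functional calculus). Its dimension is the dimension of the
positive part of the spectrum. -/
def positiveSpectralSubspace (T : H →L[ℂ] H) : Submodule ℂ H :=
  (LinearMap.range (T⁺ : H →L[ℂ] H).toLinearMap).topologicalClosure

/-- The spectral subspace of a bounded self-adjoint `T` for `(-∞, 0)`. -/
def negativeSpectralSubspace (T : H →L[ℂ] H) : Submodule ℂ H :=
  (LinearMap.range (T⁻ : H →L[ℂ] H).toLinearMap).topologicalClosure

/-- The positive part of the spectrum. -/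
def positiveSpectrum (T : H →L[ℂ] H) : Set ℝ := {x : ℝ | 0 < x ∧ (x : ℂ) ∈ spectrum ℂ T}

/-- The positive part of the spectrum of the (self-adjoint) operator `T` consists of exactly `k`
points, each of which is a simple eigenvalue. -/
def HasSimplePositiveSpectrum (T : H →L[ℂ] H) (k : ℕ) : Prop :=
  (positiveSpectrum T).Finite ∧ (positiveSpectrum T).ncard = k ∧
    ∀ x ∈ positiveSpectrum T,
      Module.finrank ℂ (Module.End.eigenspace (T : H →ₗ[ℂ] H) (x : ℂ)) = 1

end Spectral

end PTBreather

end

/-! At `ε = 0` everything decouples. The profile is `z` at node `0` and zero elsewhere, and the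
Hessian is a direct sum of `4 × 4` Hermitian blocks, each explicitly diagonalizable
(`exists_block_eigenbasis`). An empty node contributes `Ω ± √(E² + γ²)`, each twice; since `E ≠ ±E₀`
these do not vanish, and their signs depend on whether `|E|` exceeds `E₀`. At node `0` the dimer
equation reads `E = (Ω + 8A²) cos 2θ`, `γ = (Ω + 4A²) sin 2θ`. One pair of eigenvalues is then `0`
and `2(Ω + 4A²)`. The other pair has the product `(Ω + 12A²)² - R²`, whose sign is that of `2(Ω +
4A²)³ - Ωγ²` (`blockEigenvalue_dimer`). This gives three positive eigenvalues on branches (a) and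
(b), and exactly one on (c), where `Ω ≠ -2|γ|` excludes a degenerate point.

The breather comes from a simplified Newton iteration around the decoupled profile
(`exists_unique_breather`). The on-site Jacobian is invertible exactly when the product of the first
two block eigenvalues is nonzero, so the spectral computation also supplies the nondegeneracy needed
here.

For small `ε` the Hessian is norm-close to the diagonal operator, which has finitely many distinct
eigenvalues. Simple isolated eigenvalues persist as simple ones (`exists_simple_eigenvalue_of_gap`).
The one near `0` cannot move, because the gauge mode is an exact null vector. Infinite-dimensional
spectral subspaces persist by comparing quadratic forms, and no further positive spectrum appears
(`ker_and_spectrum_of_diagonal`). -/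

namespace PTBreather

/-! ### Bounded self-adjoint operators: lower bounds, eigenvectors and spectrum -/

section SpectralTheory

variable {H : Type*} [NormedAddCommGroup H] [InnerProductSpace ℂ H]

theorem mem_spectrum_real_iff {T : H →L[ℂ] H} {ν : ℝ} :
    (ν : ℂ) ∈ spectrum ℂ T ↔ ¬ IsUnit (T - algebraMap ℂ (H →L[ℂ] H) ν) := by
  rw [spectrum.mem_iff, ← IsUnit.neg_iff, neg_sub]

theorem sub_algebraMap_apply (T : H →L[ℂ] H) (ν : ℂ) (x : H) :
    (T - algebraMap ℂ (H →L[ℂ] H) ν) x = T x - ν • x := by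
  simp [Algebra.algebraMap_eq_smul_one]

variable [CompleteSpace H]

/-- An injective self-adjoint operator that is bounded below on a hyperplane is invertible. -/
theorem isUnit_of_bounded_below_on_hyperplane {K : H →L[ℂ] H} (hK : IsSelfAdjoint K)
    (hinj : ∀ x, K x = 0 → x = 0) (e : H) {c : ℝ} (hc : 0 < c)
    (hb : ∀ x, inner ℂ e x = 0 → c * ‖x‖ ≤ ‖K x‖) : IsUnit K := by
  set s : Submodule ℂ H := LinearMap.ker (innerSL ℂ e).toLinearMap with hs
  have hsc : IsClosed (s : Set H) := (innerSL ℂ e).isClosed_ker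
  have : CompleteSpace s := hsc.completeSpace_coe
  have hcofg : s.CoFG := by
    have : Module.Finite ℂ (H ⧸ s) :=
      Module.Finite.equiv (LinearMap.quotKerEquivRange (innerSL ℂ e).toLinearMap).symm
    infer_instance
  have hanti : AntilipschitzWith (Real.toNNReal c⁻¹) (K.comp s.subtypeL) := by
    refine (K.comp s.subtypeL).antilipschitz_of_bound fun x => ?_
    rw [Real.coe_toNNReal _ (inv_nonneg.2 hc.le), inv_mul_eq_div, le_div_iff₀ hc, mul_comm]
    exact hb x (by simpa [hs] using x.2)
  have hmap : IsClosed (s.map K.toLinearMap : Set H) := by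
    have := hanti.isClosed_range (K.comp s.subtypeL).uniformContinuous
    convert! this using 1
    ext y
    simp
  -- The hyperplane has finite codimension, so closedness of its image passes to the whole range.
  -- Density of the range then follows from self-adjointness and injectivity.
  have hcl : IsClosed (K.toLinearMap.range : Set H) :=
    LinearMap.isClosed_range_of_isClosed_map_of_finiteDimensional_quotient hmap
  have hker : K.ker = ⊥ := by
    rw [Submodule.eq_bot_iff]
    exact fun x hx => hinj x hx
  have horth : K.rangeᗮ = ⊥ := by
    rw [ContinuousLinearMap.IsStarNormal.orthogonal_range hK.isStarNormal, hker]
  rw [ContinuousLinearMap.isUnit_iff_bijective]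
  refine ⟨LinearMap.ker_eq_bot.1 hker, LinearMap.range_eq_top.1 ?_⟩
  rw [← hcl.submodule_topologicalClosure_eq, Submodule.topologicalClosure_eq_top_iff]
  exact horth

theorem isSelfAdjoint_sub_real {T : H →L[ℂ] H} (hT : IsSelfAdjoint T) (ν : ℝ) :
    IsSelfAdjoint (T - algebraMap ℂ (H →L[ℂ] H) ν) :=
  hT.sub (IsSelfAdjoint.algebraMap _ (Complex.conj_ofReal ν))

/-- A point of the spectrum at which the operator is bounded below on a hyperplane is an
eigenvalue. -/
theorem exists_eigenvector_of_mem_spectrum {T : H →L[ℂ] H} (hT : IsSelfAdjoint T) {ν : ℝ}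
    (hν : (ν : ℂ) ∈ spectrum ℂ T) (e : H) {c : ℝ} (hc : 0 < c)
    (hb : ∀ x, inner ℂ e x = 0 → c * ‖x‖ ≤ ‖T x - (ν : ℂ) • x‖) :
    ∃ x, x ≠ 0 ∧ T x = (ν : ℂ) • x := by
  by_contra! h
  refine mem_spectrum_real_iff.1 hν
    (isUnit_of_bounded_below_on_hyperplane (isSelfAdjoint_sub_real hT ν) (fun x hx => ?_) e hc
      (fun x hx => ?_))
  · rw [sub_algebraMap_apply, sub_eq_zero] at hx
    by_contra hx0
    exact h x hx0 hx
  · rw [sub_algebraMap_apply]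
    exact hb x hx

theorem notMem_spectrum_of_bounded_below {T : H →L[ℂ] H} (hT : IsSelfAdjoint T) {ν : ℝ}
    {c : ℝ} (hc : 0 < c) (hb : ∀ x, c * ‖x‖ ≤ ‖T x - (ν : ℂ) • x‖) :
    (ν : ℂ) ∉ spectrum ℂ T := by
  intro hν
  -- With `e = 0` the "hyperplane" is the whole space.
  obtain ⟨x, hx0, hx⟩ := exists_eigenvector_of_mem_spectrum hT hν 0 hc (fun x _ => hb x)
  have := hb x
  rw [hx, sub_self, norm_zero] at this
  nlinarith [norm_pos_iff.2 hx0]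

theorem mem_spectrum_of_eigenvector {T : H →L[ℂ] H} {ν : ℝ} {x : H} (hx0 : x ≠ 0)
    (hx : T x = (ν : ℂ) • x) : (ν : ℂ) ∈ spectrum ℂ T := by
  rw [mem_spectrum_real_iff]
  intro hu
  refine hx0 ((ContinuousLinearMap.isUnit_iff_bijective.1 hu).1 ?_)
  rw [sub_algebraMap_apply, hx, sub_self, map_zero]

/-- A self-adjoint operator without spectrum in an interval is bounded below by the distance. -/
theorem le_norm_sub_of_spectrum {T : H →L[ℂ] H} (hT : IsSelfAdjoint T) {l r : ℝ} (hr : 0 ≤ r)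
    (h : ∀ ν : ℝ, (ν : ℂ) ∈ spectrum ℂ T → r ≤ |ν - l|) (x : H) :
    r * ‖x‖ ≤ ‖T x - (l : ℂ) • x‖ := by
  -- The polynomial `(s - l)² - r²` is nonnegative on the spectrum, so the functional calculus gives
  -- `(T - l)² ≥ r²` as operators; testing on `x` yields the claim.
  have hcfc : cfc (fun s : ℝ => (s - l) * (s - l) - r ^ 2) T =
      (T - algebraMap ℂ (H →L[ℂ] H) l) * (T - algebraMap ℂ (H →L[ℂ] H) l)
        - algebraMap ℂ (H →L[ℂ] H) ((r ^ 2 : ℝ) : ℂ) := by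
    have h1 : cfc (fun s : ℝ => s - l) T = T - algebraMap ℂ (H →L[ℂ] H) l := by
      rw [cfc_sub (fun s : ℝ => s) (fun _ => l) T, cfc_id' ℝ T, cfc_const l T]
      rfl
    rw [cfc_sub (fun s : ℝ => (s - l) * (s - l)) (fun _ => r ^ 2) T,
      cfc_mul (fun s : ℝ => s - l) (fun s : ℝ => s - l) T, h1, cfc_const (r ^ 2) T]
    rfl
  have hnn : 0 ≤ cfc (fun s : ℝ => (s - l) * (s - l) - r ^ 2) T := by
    refine cfc_nonneg fun s hs => ?_
    have := h s (by
      have := (spectrum.algebraMap_mem_iff ℂ (r := s) (a := T)).2 hs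
      exact this)
    have h2 : r ^ 2 ≤ |s - l| ^ 2 := by gcongr
    rw [sq_abs] at h2
    nlinarith
  rw [hcfc, ContinuousLinearMap.nonneg_iff_isPositive] at hnn
  have h3 := hnn.re_inner_nonneg_left x
  have hK := isSelfAdjoint_sub_real hT l
  set K := T - algebraMap ℂ (H →L[ℂ] H) (l : ℂ) with hKdef
  have h4 : inner ℂ ((K * K - algebraMap ℂ (H →L[ℂ] H) ((r ^ 2 : ℝ) : ℂ)) x) x =
      inner ℂ (K x) (K x) - ((r ^ 2 : ℝ) : ℂ) * inner ℂ x x := by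
    have h5 : inner ℂ (K (K x)) x = inner ℂ (K x) (K x) :=
      (ContinuousLinearMap.isSelfAdjoint_iff_isSymmetric.1 hK) (K x) x
    rw [sub_algebraMap_apply, inner_sub_left, inner_smul_left, Complex.conj_ofReal]
    rw [mul_apply_eq_comp, h5]
  rw [h4] at h3
  have h6 : (r * ‖x‖) ^ 2 ≤ ‖K x‖ ^ 2 := by
    have h7 : (inner ℂ (K x) (K x) - ((r ^ 2 : ℝ) : ℂ) * inner ℂ x x).re =
        ‖K x‖ ^ 2 - r ^ 2 * ‖x‖ ^ 2 := by
      rw [inner_self_eq_norm_sq_to_K, inner_self_eq_norm_sq_to_K]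
      simp only [Complex.coe_algebraMap]
      norm_cast
    have h8 : 0 ≤ ‖K x‖ ^ 2 - r ^ 2 * ‖x‖ ^ 2 := h7 ▸ h3
    linarith [mul_pow r ‖x‖ 2]
  have h7 := abs_le_of_sq_le_sq' h6 (norm_nonneg _) |>.2
  rwa [hKdef, sub_algebraMap_apply] at h7

end SpectralTheory

/-! ### Persistence of an isolated simple eigenvalue -/

section Perturbation

variable {H : Type*} [NormedAddCommGroup H] [InnerProductSpace ℂ H]

theorem norm_sub_le_norm_add_of_opNorm_le {T T₀ : H →L[ℂ] H} {δ : ℝ} (hd : ‖T - T₀‖ ≤ δ) (ν : ℂ)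
    (x : H) : ‖T₀ x - ν • x‖ ≤ ‖T x - ν • x‖ + δ * ‖x‖ := by
  have h1 : T₀ x - ν • x = (T x - ν • x) - (T - T₀) x := by
    rw [sub_apply]; abel
  rw [h1]
  exact (norm_sub_le _ _).trans (by gcongr; exact (T - T₀).le_of_opNorm_le hd x)

theorem norm_sub_real_smul_le (T : H →L[ℂ] H) (l ν : ℝ) (x : H) :
    ‖T x - (l : ℂ) • x‖ ≤ ‖T x - (ν : ℂ) • x‖ + |ν - l| * ‖x‖ := by
  have h1 : T x - (l : ℂ) • x = (T x - (ν : ℂ) • x) + ((ν - l : ℝ) : ℂ) • x := by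
    push_cast; rw [sub_smul]; abel
  rw [h1]
  refine (norm_add_le _ _).trans ?_
  rw [norm_smul, Complex.norm_real, Real.norm_eq_abs]

variable [CompleteSpace H]

/-- Persistence of an isolated simple eigenvalue under a small self-adjoint perturbation. -/
theorem exists_simple_eigenvalue_of_gap {T T₀ : H →L[ℂ] H} (hT : IsSelfAdjoint T) {l : ℝ} {e : H}
    (he : e ≠ 0) (hTe : T₀ e = (l : ℂ) • e) {g δ : ℝ} (hδ : 0 < δ) (hδg : 8 * δ ≤ g)
    (hgap : ∀ x, inner ℂ e x = 0 → g * ‖x‖ ≤ ‖T₀ x - (l : ℂ) • x‖) (hd : ‖T - T₀‖ ≤ δ) :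
    ∃ μ : ℝ, |μ - l| < 2 * δ ∧ (μ : ℂ) ∈ spectrum ℂ T ∧
      Module.finrank ℂ (Module.End.eigenspace (T : H →ₗ[ℂ] H) (μ : ℂ)) = 1 ∧
      ∀ ν : ℝ, (ν : ℂ) ∈ spectrum ℂ T → |ν - l| < g / 2 → ν = μ := by
  have hgapT : ∀ x, inner ℂ e x = 0 → (g - δ) * ‖x‖ ≤ ‖T x - (l : ℂ) • x‖ := fun x hx => by
    have := hgap x hx
    have := norm_sub_le_norm_add_of_opNorm_le hd l x
    linarith
  -- As `δ ≤ g / 8`, the remaining gap `g - δ - |ν - l|` is at least `g / 4`.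
  have hgapν : ∀ ν : ℝ, |ν - l| < g / 2 → ∀ x, inner ℂ e x = 0 →
      (g / 4) * ‖x‖ ≤ ‖T x - (ν : ℂ) • x‖ := fun ν hν x hx => by
    have h1 := hgapT x hx
    have h2 := norm_sub_real_smul_le T l ν x
    have h3 : |ν - l| * ‖x‖ ≤ g / 2 * ‖x‖ := by gcongr
    have h4 : δ * ‖x‖ ≤ g / 8 * ‖x‖ := by gcongr; linarith
    have h5 := mul_nonneg (hδ.le.trans (by linarith : δ ≤ g)) (norm_nonneg x)
    linarith
  have hg : 0 < g / 4 := by linarith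
  have hev : ∀ ν : ℝ, |ν - l| < g / 2 → (ν : ℂ) ∈ spectrum ℂ T →
      ∃ x, inner ℂ e x ≠ 0 ∧ T x = (ν : ℂ) • x := by
    intro ν hν hs
    obtain ⟨x, hx0, hx⟩ := exists_eigenvector_of_mem_spectrum hT hs e hg (hgapν ν hν)
    refine ⟨x, fun h0 => ?_, hx⟩
    have := hgapν ν hν x h0
    rw [hx, sub_self, norm_zero] at this
    nlinarith [norm_pos_iff.2 hx0]
  -- The vector `e` is an approximate eigenvector of `T` with residual at most `δ‖e‖`, so `T` has
  -- spectrum within `2δ` of `l`.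
  obtain ⟨μ, hμs, hμl⟩ : ∃ μ : ℝ, (μ : ℂ) ∈ spectrum ℂ T ∧ |μ - l| < 2 * δ := by
    by_contra! h
    have h1 := le_norm_sub_of_spectrum hT (by positivity) h e
    have h2 : ‖T e - (l : ℂ) • e‖ ≤ δ * ‖e‖ := by
      rw [← hTe, ← sub_apply]
      exact (T - T₀).le_of_opNorm_le hd e
    nlinarith [norm_pos_iff.2 he]
  have hμg : |μ - l| < g / 2 := by linarith
  obtain ⟨x, hex, hx⟩ := hev μ hμg hμs
  have hx0 : x ≠ 0 := by rintro rfl; simp at hex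
  refine ⟨μ, hμl, hμs, ?_, ?_⟩
  · rw [finrank_eq_one_iff_of_nonzero' (⟨x, Module.End.mem_eigenspace_iff.2 hx⟩ :
      Module.End.eigenspace (T : H →ₗ[ℂ] H) (μ : ℂ)) (by simpa using hx0)]
    rintro ⟨y, hy⟩
    have hy' : T y = (μ : ℂ) • y := Module.End.mem_eigenspace_iff.1 hy
    -- This multiple of `x` makes the difference from `y` orthogonal to `e`, where `T - μ` is
    -- injective.
    refine ⟨inner ℂ e y / inner ℂ e x, Subtype.ext ?_⟩
    set w := (inner ℂ e y / inner ℂ e x) • x - y with hw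
    have h0 : inner ℂ e w = 0 := by
      rw [hw, inner_sub_right, inner_smul_right, div_mul_cancel₀ _ hex, sub_self]
    have h1 := hgapν μ hμg w h0
    have h2 : T w - (μ : ℂ) • w = 0 := by
      rw [hw, map_sub, map_smul, hx, hy', smul_sub, smul_comm, sub_self]
    rw [h2, norm_zero] at h1
    have h3 : w = 0 := by
      by_contra h
      nlinarith [norm_pos_iff.2 h]
    exact sub_eq_zero.1 h3
  · intro ν hνs hνl
    by_contra hne
    obtain ⟨y, hey, hy⟩ := hev ν hνl hνs
    have hxy : inner ℂ x y = 0 := by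
      have h1 : inner ℂ (T x) y = inner ℂ x (T y) :=
        (ContinuousLinearMap.isSelfAdjoint_iff_isSymmetric.1 hT) x y
      rw [hx, hy, inner_smul_left, inner_smul_right, Complex.conj_ofReal, ← sub_eq_zero,
        ← sub_mul, mul_eq_zero] at h1
      refine h1.resolve_left fun h2 => hne ?_
      exact_mod_cast (sub_eq_zero.1 h2).symm
    have hpyth : ∀ α β : ℂ, ‖α • x - β • y‖ ^ 2 = ‖α‖ ^ 2 * ‖x‖ ^ 2 + ‖β‖ ^ 2 * ‖y‖ ^ 2 := by
      intro α β
      have h1 : inner ℂ (α • x) (β • y) = 0 := by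
        rw [inner_smul_left, inner_smul_right, hxy, mul_zero, mul_zero]
      rw [@norm_sub_sq ℂ, h1, norm_smul, norm_smul]
      simp
      ring
    -- Two distinct eigenvalues near `l` would have orthogonal eigenvectors, whose span meets the
    -- complement of `e` in `w ≠ 0`. There `T - l` would have norm at most `g / 2`, against the
    -- lower bound `g - δ`.
    set w := (inner ℂ e y) • x - (inner ℂ e x) • y with hw
    have h0 : inner ℂ e w = 0 := by
      rw [hw, inner_sub_right, inner_smul_right, inner_smul_right, mul_comm, sub_self]
    have h1 := hgapT w h0
    have h2 : T w - (l : ℂ) • w =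
        (((μ - l : ℝ) : ℂ) * inner ℂ e y) • x - (((ν - l : ℝ) : ℂ) * inner ℂ e x) • y := by
      rw [hw, map_sub, map_smul, map_smul, hx, hy]
      push_cast
      module
    have hwn := hpyth (inner ℂ e y) (inner ℂ e x)
    rw [← hw] at hwn
    have hwpos : 0 < ‖w‖ ^ 2 := by
      rw [hwn]
      have := norm_pos_iff.2 hx0
      have := norm_pos_iff.2 hey
      positivity
    have h3 : ‖T w - (l : ℂ) • w‖ ^ 2 ≤ (g / 2) ^ 2 * ‖w‖ ^ 2 := by
      rw [h2, hpyth, hwn, norm_mul, norm_mul, Complex.norm_real, Complex.norm_real,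
        Real.norm_eq_abs, Real.norm_eq_abs, mul_pow, mul_pow, mul_add, mul_assoc, mul_assoc]
      gcongr
    have h4 : ((g - δ) * ‖w‖) ^ 2 ≤ ‖T w - (l : ℂ) • w‖ ^ 2 :=
      pow_le_pow_left₀ (mul_nonneg (by linarith) (norm_nonneg _)) h1 2
    have h5 : (g / 2) ^ 2 < (g - δ) ^ 2 := by
      apply pow_lt_pow_left₀ <;> linarith
    nlinarith

end Perturbation

/-! ### Perturbations of a diagonal operator -/

section Diagonal

variable {H : Type*} [NormedAddCommGroup H] [InnerProductSpace ℂ H]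
  {ι : Type*} (b : HilbertBasis ι ℂ H)

theorem re_inner_mul_inner (x y : H) :
    (inner ℂ x y * inner ℂ y x : ℂ).re = ‖(inner ℂ y x : ℂ)‖ ^ 2 := by
  rw [← inner_conj_symm x y, ← Complex.normSq_eq_conj_mul_self, Complex.ofReal_re,
    Complex.normSq_eq_norm_sq]

theorem hasSum_norm_inner_sq (x : H) : HasSum (fun k => ‖inner ℂ (b k) x‖ ^ 2) (‖x‖ ^ 2) := by
  have h := Complex.hasSum_re (b.hasSum_inner_mul_inner x x)
  have h1 : (inner ℂ x x : ℂ).re = ‖x‖ ^ 2 := inner_self_eq_norm_sq (𝕜 := ℂ) x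
  rw [h1] at h
  refine h.congr_fun fun k => (re_inner_mul_inner _ _).symm

variable [CompleteSpace H] {T₀ : H →L[ℂ] H} (hT₀ : IsSelfAdjoint T₀) {l : ι → ℝ}
  (hdiag : ∀ k, T₀ (b k) = (l k : ℂ) • b k)

include hT₀ hdiag in
theorem inner_basis_apply (k : ι) (x : H) : inner ℂ (b k) (T₀ x) = l k * inner ℂ (b k) x := by
  have h1 : inner ℂ (T₀ (b k)) x = inner ℂ (b k) (T₀ x) :=
    (ContinuousLinearMap.isSelfAdjoint_iff_isSymmetric.1 hT₀) (b k) x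
  rw [← h1, hdiag, inner_smul_left, Complex.conj_ofReal]

include hT₀ hdiag in
-- Parseval, term by term. Only indices with a nonzero coefficient need a gap, so the bound also
-- covers the complement of a single basis vector.
theorem le_norm_sub_of_diagonal {ν g : ℝ} (hg : 0 ≤ g) {x : H}
    (h : ∀ k, inner ℂ (b k) x ≠ 0 → g ≤ |l k - ν|) : g * ‖x‖ ≤ ‖T₀ x - (ν : ℂ) • x‖ := by
  refine abs_le_of_sq_le_sq' ?_ (norm_nonneg _) |>.2
  rw [mul_pow]
  refine hasSum_le (fun k => ?_) ((hasSum_norm_inner_sq b x).mul_left (g ^ 2))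
    (hasSum_norm_inner_sq b (T₀ x - (ν : ℂ) • x))
  rw [inner_sub_right, inner_basis_apply b hT₀ hdiag, inner_smul_right, ← sub_mul, norm_mul,
    mul_pow, ← Complex.ofReal_sub, Complex.norm_real, Real.norm_eq_abs]
  by_cases hk : inner ℂ (b k) x = 0
  · simp [hk]
  · gcongr
    exact h k hk

include hT₀ hdiag in
theorem le_inner_of_diagonal {c : ℝ} {x : H}
    (h : ∀ k, inner ℂ (b k) x ≠ 0 → c ≤ l k) : c * ‖x‖ ^ 2 ≤ (inner ℂ x (T₀ x)).re := by
  have h1 : HasSum (fun k => l k * ‖inner ℂ (b k) x‖ ^ 2) (inner ℂ x (T₀ x)).re := by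
    refine (Complex.hasSum_re (b.hasSum_inner_mul_inner x (T₀ x))).congr_fun fun k => ?_
    rw [inner_basis_apply b hT₀ hdiag, mul_left_comm, Complex.re_ofReal_mul,
      re_inner_mul_inner]
  refine hasSum_le (fun k => ?_) ((hasSum_norm_inner_sq b x).mul_left c) h1
  by_cases hk : inner ℂ (b k) x = 0
  · simp [hk]
  · exact mul_le_mul_of_nonneg_right (h k hk) (by positivity)

include hT₀ hdiag in
-- On the span of the `b k` with `l k ≥ c` the form of `T` is at least `c - ‖T - T₀‖ > 0`, whereas
-- on the kernel of `T⁺` it equals that of `-T⁻` and is nonpositive. Hence `T⁺` is injective on an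
-- infinite-dimensional space.
theorem positiveSpectralSubspace_infinite {c : ℝ} (hinf : {k | c ≤ l k}.Infinite)
    {T : H →L[ℂ] H} (hT : IsSelfAdjoint T) (hd : ‖T - T₀‖ < c) :
    ¬ FiniteDimensional ℂ (positiveSpectralSubspace T) := by
  intro hfd
  set S := {k | c ≤ l k} with hS
  set M : Submodule ℂ H := Submodule.span ℂ (Set.range fun k : S => b k)
  have hM : ∀ x ∈ M, ∀ k, inner ℂ (b k) x ≠ 0 → c ≤ l k := by
    intro x hx k hk
    by_contra hkS
    refine hk ?_
    have : M ≤ LinearMap.ker (innerSL ℂ (b k)).toLinearMap := by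
      refine Submodule.span_le.2 ?_
      rintro _ ⟨j, rfl⟩
      have hkj : k ≠ j := fun h => hkS (h ▸ j.2)
      simpa using b.orthonormal.2 hkj
    simpa using this hx
  have hinj : ∀ x ∈ M, (T⁺ : H →L[ℂ] H) x = 0 → x = 0 := by
    intro x hx h0
    have h1 := le_inner_of_diagonal b hT₀ hdiag (hM x hx)
    have h2 : T x = -((T⁻ : H →L[ℂ] H) x) := by
      conv_lhs => rw [← CFC.posPart_sub_negPart T hT]
      rw [sub_apply, h0, zero_sub]
    have h3 : 0 ≤ (inner ℂ x ((T⁻ : H →L[ℂ] H) x)).re :=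
      (ContinuousLinearMap.nonneg_iff_isPositive _ |>.1 (CFC.negPart_nonneg T)).re_inner_nonneg_right
        x
    have h4 : inner ℂ x (T₀ x) = -inner ℂ x ((T⁻ : H →L[ℂ] H) x) - inner ℂ x ((T - T₀) x) := by
      rw [← inner_neg_right, ← h2, sub_apply, inner_sub_right]
      ring
    have h5 : |(inner ℂ x ((T - T₀) x)).re| ≤ ‖x‖ * (‖T - T₀‖ * ‖x‖) :=
      (Complex.abs_re_le_norm _).trans ((norm_inner_le_norm _ _).trans
        (by gcongr; exact (T - T₀).le_opNorm x))
    rw [h4, Complex.sub_re, Complex.neg_re] at h1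
    by_contra hx0
    have h6 : 0 < ‖x‖ ^ 2 := by have := norm_pos_iff.2 hx0; positivity
    nlinarith [(abs_le.1 h5).1]
  let f : M →ₗ[ℂ] positiveSpectralSubspace T :=
    ((T⁺ : H →L[ℂ] H).toLinearMap.codRestrict (positiveSpectralSubspace T)
      (fun x => Submodule.le_topologicalClosure _ ⟨x, rfl⟩)).comp M.subtype
  have hf : Function.Injective f := by
    rw [← LinearMap.ker_eq_bot, Submodule.eq_bot_iff]
    intro x hx
    exact Subtype.ext (hinj x x.2 (congrArg Subtype.val hx))
  have : FiniteDimensional ℂ M := FiniteDimensional.of_injective f hf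
  have hli : LinearIndependent ℂ
      (fun k : S => (⟨b k, Submodule.subset_span ⟨k, rfl⟩⟩ : M)) :=
    LinearIndependent.of_comp M.subtype
      (b.orthonormal.linearIndependent.comp (fun k : S => (k : ι)) Subtype.val_injective)
  exact hinf (Set.finite_coe_iff.1 hli.finite)

include hT₀ hdiag in
-- Apply the positive case to `-T`, using `(-T)⁺ = T⁻`.
theorem negativeSpectralSubspace_infinite {c : ℝ} (hinf : {k | l k ≤ -c}.Infinite)
    {T : H →L[ℂ] H} (hT : IsSelfAdjoint T) (hd : ‖T - T₀‖ < c) :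
    ¬ FiniteDimensional ℂ (negativeSpectralSubspace T) := by
  have h := positiveSpectralSubspace_infinite b (T₀ := -T₀) hT₀.neg (l := fun k => -l k)
    (fun k => by simp [hdiag]) (c := c) (by simpa only [le_neg] using hinf) hT.neg
    (by rw [← neg_sub', norm_neg]; exact hd)
  rwa [positiveSpectralSubspace, CFC.posPart_neg] at h

include hT₀ hdiag in
/-- A self-adjoint operator with nontrivial kernel that is close to a diagonal operator with finitely
many eigenvalues, a simple eigenvalue zero and finitely many, simple positive eigenvalues. -/
theorem ker_and_spectrum_of_diagonal (hl : (Set.range l).Finite) {o : ι} (ho : l o = 0)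
    (ho' : ∀ k, l k = 0 → k = o) :
    ∃ δ > 0, ∀ T : H →L[ℂ] H, IsSelfAdjoint T → ‖T - T₀‖ ≤ δ → ∀ ψ, ψ ≠ 0 → T ψ = 0 →
      (Module.finrank ℂ (LinearMap.ker T.toLinearMap) = 1 ∧
        LinearMap.ker T.toLinearMap = Submodule.span ℂ {ψ}) ∧
      ({k | 0 < l k}.Infinite → ¬ FiniteDimensional ℂ (positiveSpectralSubspace T)) ∧
      ({k | l k < 0}.Infinite → ¬ FiniteDimensional ℂ (negativeSpectralSubspace T)) ∧
      (∀ J : Finset ι, (∀ k, k ∈ J ↔ 0 < l k) → Set.InjOn l J →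
        HasSimplePositiveSpectrum T J.card) := by
  -- Finitely many eigenvalues, possibly of infinite multiplicity, are uniformly separated.
  obtain ⟨g, hg, hgap⟩ : ∃ g > 0, ∀ k j, l k ≠ l j → g ≤ |l k - l j| := by
    have hfin : ((fun p : ℝ × ℝ => |p.1 - p.2|) '' (Set.range l ×ˢ Set.range l)).Finite :=
      (hl.prod hl).image _
    obtain ⟨g, hg, h⟩ := (hfin.subset Set.sdiff_subset :
      (((fun p : ℝ × ℝ => |p.1 - p.2|) '' (Set.range l ×ˢ Set.range l)) \ {0}).Finite).isClosed
        |>.isOpen_compl.mem_nhds (show (0 : ℝ) ∈ _ by simp) |> Metric.mem_nhds_iff.1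
    refine ⟨g, hg, fun k j hkj => ?_⟩
    by_contra! hlt
    refine h (show |l k - l j| ∈ Metric.ball (0 : ℝ) g by simpa using hlt) ⟨?_, ?_⟩
    · exact ⟨(l k, l j), ⟨⟨k, rfl⟩, ⟨j, rfl⟩⟩, rfl⟩
    · simpa [sub_eq_zero] using hkj
  refine ⟨g / 8, by positivity, fun T hT hd ψ hψ0 hψ => ?_⟩
  have hsimple : ∀ j, (∀ k, l k = l j → k = j) → ∃ μ : ℝ, |μ - l j| < 2 * (g / 8) ∧
      (μ : ℂ) ∈ spectrum ℂ T ∧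
      Module.finrank ℂ (Module.End.eigenspace (T : H →ₗ[ℂ] H) (μ : ℂ)) = 1 ∧
      ∀ ν : ℝ, (ν : ℂ) ∈ spectrum ℂ T → |ν - l j| < g / 2 → ν = μ := by
    intro j hj
    refine exists_simple_eigenvalue_of_gap hT (b.orthonormal.ne_zero j) (hdiag j) (by positivity)
      (by linarith) (fun x hx => ?_) hd
    refine le_norm_sub_of_diagonal b hT₀ hdiag hg.le fun k hk => hgap k j fun h => hk ?_
    rw [hj k h, hx]
  have hpsi : T ψ = ((0 : ℝ) : ℂ) • ψ := by simpa using hψ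
  obtain ⟨μ₀, -, -, hfr, huniq⟩ := hsimple o (fun k hk => ho' k (hk.trans ho))
  -- The null vector `ψ` puts `0` in the spectrum of `T`, so `0` is the unique spectral point
  -- continuing `l o = 0`.
  have hμ₀ : 0 = μ₀ := huniq 0 (mem_spectrum_of_eigenvector hψ0 hpsi) (by rw [ho]; simpa using hg)
  subst hμ₀
  have hker : Module.End.eigenspace (T : H →ₗ[ℂ] H) ((0 : ℝ) : ℂ) = LinearMap.ker T.toLinearMap := by
    simp [Module.End.eigenspace_zero]
  rw [hker] at hfr
  refine ⟨⟨hfr, ?_⟩, fun hinf => ?_, fun hinf => ?_, fun J hJ hinj => ?_⟩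
  · have h1 := (finrank_eq_one_iff_of_nonzero' (⟨ψ, hψ⟩ : LinearMap.ker T.toLinearMap)
      (by simpa [Subtype.ext_iff] using hψ0)).1 hfr
    refine le_antisymm (fun y hy => ?_) ?_
    · obtain ⟨c, hc⟩ := h1 ⟨y, hy⟩
      exact Submodule.mem_span_singleton.2 ⟨c, congrArg Subtype.val hc⟩
    · rw [Submodule.span_singleton_le_iff_mem]
      exact hψ
  · refine positiveSpectralSubspace_infinite b hT₀ hdiag (c := g) (hinf.mono fun k hk => ?_) hT
      (by linarith)
    have := hgap k o (by rw [ho]; exact ne_of_gt hk)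
    rwa [ho, sub_zero, abs_of_pos hk] at this
  · refine negativeSpectralSubspace_infinite b hT₀ hdiag (c := g) (hinf.mono fun k hk => ?_) hT
      (by linarith)
    have := hgap k o (by rw [ho]; exact ne_of_lt hk)
    rw [ho, sub_zero, abs_of_neg hk] at this
    exact le_neg.1 this
  · have hJs : ∀ j ∈ J, ∀ k, l k = l j → k = j := fun j hj k hk =>
      hinj (by simpa [hJ, hk] using (hJ j).1 hj) hj hk
    choose! m hm using fun j (hj : j ∈ J) => hsimple j (hJs j hj)
    have hlg : ∀ j ∈ J, g ≤ l j := fun j hj => by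
      have := hgap j o (by rw [ho]; exact ne_of_gt ((hJ j).1 hj))
      rwa [ho, sub_zero, abs_of_pos ((hJ j).1 hj)] at this
    have hset : positiveSpectrum T = m '' J := by
      ext ν
      constructor
      · rintro ⟨hν, hνs⟩
        by_contra hnot
        refine notMem_spectrum_of_bounded_below hT (c := g / 4) (by positivity) (fun x => ?_) hνs
        have h1 : g / 2 * ‖x‖ ≤ ‖T₀ x - (ν : ℂ) • x‖ := by
          -- A positive `ν` within `g / 2` of some `l k` is impossible for `l k < 0`, forced to be
          -- `0` for `l k = 0`, and listed in `m '' J` for `l k > 0`.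
          refine le_norm_sub_of_diagonal b hT₀ hdiag (by positivity) fun k _ => ?_
          by_contra! hlt
          rw [abs_sub_comm] at hlt
          rcases lt_trichotomy (l k) 0 with hk | hk | hk
          · have := hgap k o (by rw [ho]; exact ne_of_lt hk)
            rw [ho, sub_zero, abs_of_neg hk] at this
            rw [abs_of_pos (by linarith)] at hlt
            linarith
          · exact hν.ne' (huniq ν hνs (by rwa [ho, ← hk]))
          · exact hnot ⟨k, (hJ k).2 hk, ((hm k ((hJ k).2 hk)).2.2.2 ν hνs hlt).symm⟩
        have h2 := norm_sub_le_norm_add_of_opNorm_le hd ν x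
        have h3 := mul_nonneg hg.le (norm_nonneg x)
        linarith
      · rintro ⟨j, hj, rfl⟩
        have h1 := (abs_lt.1 (hm j hj).1).1
        have h2 := hlg j hj
        exact ⟨by linarith, (hm j hj).2.1⟩
    have hminj : Set.InjOn m J := by
      intro j hj k hk hjk
      refine hinj hj hk ?_
      by_contra hne
      have h1 := hgap j k hne
      have h2 := (hm j hj).1
      have h3 := (hm k hk).1
      rw [hjk, abs_sub_comm] at h2
      have h4 := abs_sub_le (l j) (m k) (l k)
      linarith
    refine ⟨?_, ?_, ?_⟩
    · rw [hset]
      exact J.finite_toSet.image m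
    · rw [hset, hminj.ncard_image, Set.ncard_coe_finset]
    · rw [hset]
      rintro _ ⟨j, hj, rfl⟩
      exact (hm j hj).2.2.1

end Diagonal

/-! ### The eigenvalues of the blocks -/

/-- The off-diagonal entry of the block on vectors `(p, q, q, p)`. -/
noncomputable def symmEntry (γ E : ℝ) (z : ℂ) : ℂ := 6 * (z ^ 2 + conj z ^ 2) - E - Complex.I * γ

/-- The off-diagonal entry of the block on vectors `(p, q, -q, -p)`. -/
noncomputable def antiEntry (γ E : ℝ) (z : ℂ) : ℂ := E + Complex.I * γ - 2 * (z ^ 2 + conj z ^ 2)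

/-- The eigenvalues of the block. -/
noncomputable def blockEigenvalue (γ Ω E : ℝ) (z : ℂ) : Fin 4 → ℝ :=
  ![Ω + 12 * ‖z‖ ^ 2 + ‖symmEntry γ E z‖, Ω + 12 * ‖z‖ ^ 2 - ‖symmEntry γ E z‖,
    Ω + 4 * ‖z‖ ^ 2 + ‖antiEntry γ E z‖, Ω + 4 * ‖z‖ ^ 2 - ‖antiEntry γ E z‖]

/-- The phase exists also at `w = 0`, so the block eigenvectors need no case distinction. -/
theorem exists_phase (w : ℂ) : ∃ ω : ℂ, ω * conj ω = 1 ∧ w = ‖w‖ * ω ∧ conj w = ‖w‖ * conj ω := by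
  refine ⟨Complex.exp (w.arg * Complex.I), ?_, ?_, ?_⟩
  · rw [Complex.mul_conj, Complex.normSq_eq_norm_sq, Complex.norm_exp_ofReal_mul_I]; simp
  · exact (Complex.norm_mul_exp_arg_mul_I w).symm
  · conv_lhs => rw [← Complex.norm_mul_exp_arg_mul_I w]
    rw [map_mul, Complex.conj_ofReal]

theorem inner_vec4 (a b c d a' b' c' d' : ℂ) :
    inner ℂ !₂[a, b, c, d] !₂[a', b', c', d'] =
      a' * conj a + b' * conj b + c' * conj c + d' * conj d := by
  simp [PiLp.inner_apply, Fin.sum_univ_four]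

/-- The block commutes with reversing the four coordinates. On each of the two symmetry classes it
is a `2 × 2` Hermitian matrix with equal diagonal entries `s` and off-diagonal entry `w`, with
eigenvalues `s ± |w|` and eigenvectors `(ω, ±1)`, where `ω` is the phase of `w`. -/
theorem exists_block_eigenbasis (γ Ω E : ℝ) (z : ℂ) :
    ∃ b : OrthonormalBasis (Fin 4) ℂ (EuclideanSpace ℂ (Fin 4)),
      ∀ i, blockCLM γ Ω E z (b i) = (blockEigenvalue γ Ω E z i : ℂ) • b i := by
  obtain ⟨ω, hω, hp, hp'⟩ := exists_phase (symmEntry γ E z)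
  obtain ⟨ω', hω', hq, hq'⟩ := exists_phase (antiEntry γ E z)
  set P := ‖symmEntry γ E z‖ with hP
  set Q := ‖antiEntry γ E z‖ with hQ
  let v : Fin 4 → EuclideanSpace ℂ (Fin 4) :=
    ![!₂[ω / 2, 1 / 2, 1 / 2, ω / 2], !₂[ω / 2, -1 / 2, -1 / 2, ω / 2],
      !₂[ω' / 2, 1 / 2, -1 / 2, -ω' / 2], !₂[ω' / 2, -1 / 2, 1 / 2, -ω' / 2]]
  have hv : Orthonormal ℂ v := by
    rw [orthonormal_iff_ite]
    intro i j
    fin_cases i <;> fin_cases j <;>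
      simp [v, inner_vec4, Complex.conj_ofNat, -inner_self_eq_norm_sq_to_K] <;>
      first | ring1 | linear_combination hω / 2 | linear_combination hω' / 2
  have heig : ∀ i, blockCLM γ Ω E z (v i) = (blockEigenvalue γ Ω E z i : ℂ) • v i := by
    simp only [symmEntry, map_sub, map_mul, map_add, map_pow, Complex.conj_conj,
      Complex.conj_ofReal, Complex.conj_I, Complex.conj_ofNat] at hp hp'
    simp only [antiEntry, map_sub, map_mul, map_add, map_pow, Complex.conj_conj,
      Complex.conj_ofReal, Complex.conj_I, Complex.conj_ofNat] at hq hq'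
    intro i
    ext j
    fin_cases i <;> fin_cases j <;>
      simp [v, blockCLM, block, blockEigenvalue,
        ← hP, ← hQ]
    all_goals first
      | linear_combination hp / 2
      | linear_combination -hp / 2
      | linear_combination hq / 2
      | linear_combination -hq / 2
      | linear_combination (ω / 2) * hp' + (P / 2 : ℂ) * hω
      | linear_combination (ω' / 2) * hq' + (Q / 2 : ℂ) * hω'
      | linear_combination -(ω' / 2) * hq' - (Q / 2 : ℂ) * hω'
  refine ⟨(basisOfOrthonormalOfCardEqFinrank hv (by simp)).toOrthonormalBasis (by simpa using hv),
    fun i => ?_⟩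
  simpa using heig i

/-! ### A Hilbert basis of `ℓ²(ℤ; ℂ⁴)` adapted to the blocks -/

theorem exists_hilbertBasis_single
    (B : ℤ → OrthonormalBasis (Fin 4) ℂ (EuclideanSpace ℂ (Fin 4))) :
    ∃ b : HilbertBasis (ℤ × Fin 4) ℂ Seq4, ∀ k, b k = lp.single 2 k.1 (B k.1 k.2) := by
  let v : ℤ × Fin 4 → Seq4 := fun k => lp.single 2 k.1 (B k.1 k.2)
  have hv : Orthonormal ℂ v := by
    rw [orthonormal_iff_ite]
    rintro ⟨n, i⟩ ⟨m, j⟩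
    rw [lp.inner_single_left, lp.single_apply]
    by_cases h : m = n
    · subst h
      simp [orthonormal_iff_ite.1 (B m).orthonormal]
    · rw [Pi.single_eq_of_ne (Ne.symm h), inner_zero_right, if_neg]
      rintro ⟨⟩
      exact h rfl
  have hsp : (Submodule.span ℂ (Set.range v))ᗮ = ⊥ := by
    rw [Submodule.eq_bot_iff]
    intro x hx
    ext1
    funext n
    have h0 : (B n).repr (x n) = 0 := by
      ext i
      have := hx _ (Submodule.subset_span ⟨(n, i), rfl⟩)
      rw [lp.inner_single_left] at this
      simpa [OrthonormalBasis.repr_apply_apply] using this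
    simpa using h0
  exact ⟨HilbertBasis.mkOfOrthogonalEqBot hv hsp, fun k => by
    rw [HilbertBasis.coe_mkOfOrthogonalEqBot]⟩

theorem blockOp_single (γ Ω E : ℝ) (U : Seq) (n : ℤ) (x : EuclideanSpace ℂ (Fin 4)) :
    blockOp γ Ω E U (lp.single 2 n x) = lp.single 2 n (blockCLM γ Ω E (U n) x) := by
  ext1
  funext m
  rw [blockOp_apply, lp.single_apply, lp.single_apply]
  by_cases h : m = n
  · subst h; simp
  · simp [Pi.single_eq_of_ne h]

/-- The blocks diagonalize the block operator. -/
theorem exists_blockOp_eigenbasis (γ Ω E : ℝ) (U : Seq) :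
    ∃ b : HilbertBasis (ℤ × Fin 4) ℂ Seq4,
      ∀ k, blockOp γ Ω E U (b k) = (blockEigenvalue γ Ω E (U k.1) k.2 : ℂ) • b k := by
  choose B hB using fun n : ℤ => exists_block_eigenbasis γ Ω E (U n)
  obtain ⟨b, hb⟩ := exists_hilbertBasis_single B
  refine ⟨b, fun k => ?_⟩
  rw [hb, blockOp_single, hB, lp.single_smul]

/-! ### Distance to the anticontinuum limit, and the gauge mode -/

theorem norm_blockOp_sub_le (γ Ω E : ℝ) (U U' : Seq) {K : ℝ} (hK : 0 ≤ K)
    (h : ∀ n, ‖blockCLM γ Ω E (U n) - blockCLM γ Ω E (U' n)‖ ≤ K) :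
    ‖blockOp γ Ω E U - blockOp γ Ω E U'‖ ≤ K := by
  have : blockOp γ Ω E U - blockOp γ Ω E U' =
      lp.mapCLM 2 (fun n => blockCLM γ Ω E (U n) - blockCLM γ Ω E (U' n)) hK h := by
    ext1 φ
    rfl
  rw [this]
  exact lp.norm_mapCLM_le 2 _ hK h

/-- The anticontinuum profile: the amplitude `z` at the node `0`, zero elsewhere. -/
noncomputable def dimerSeq (z : ℂ) : Seq := lp.single 2 (0 : ℤ) z

theorem dimerSeq_zero (z : ℂ) : dimerSeq z 0 = z := by
  rw [dimerSeq, lp.single_apply, Pi.single_eq_same]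

theorem dimerSeq_of_ne (z : ℂ) {n : ℤ} (hn : n ≠ 0) : dimerSeq z n = 0 := by
  rw [dimerSeq, lp.single_apply, Pi.single_eq_of_ne hn]

/-- The Hessian is close to its anticontinuum limit. -/
theorem norm_hessian_sub_le (γ Ω E : ℝ) (z : ℂ) {δ : ℝ} (hδ : 0 < δ) :
    ∃ r > 0, ∀ ε : ℝ, 0 < ε → ε ≤ r → ∀ U : Seq, ‖U - dimerSeq z‖ ≤ r →
      ‖hessian γ Ω E ε U - blockOp γ Ω E (dimerSeq z)‖ ≤ δ := by
  have hc : ∀ w : ℂ, ∃ r > 0, ∀ u : ℂ, ‖u - w‖ ≤ r →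
      ‖blockCLM γ Ω E u - blockCLM γ Ω E w‖ ≤ δ / 2 := fun w => by
    obtain ⟨r, hr, h⟩ := Metric.continuousAt_iff.1
      ((continuous_blockCLM γ Ω E).continuousAt (x := w)) (δ / 2) (by positivity)
    refine ⟨r / 2, by positivity, fun u hu => ?_⟩
    rw [← dist_eq_norm]
    exact (h (by rw [dist_eq_norm]; linarith)).le
  -- The limit profile takes only the values `z` and `0`, so continuity at two points is uniform in
  -- `n`.
  obtain ⟨r₁, hr₁, h₁⟩ := hc z
  obtain ⟨r₂, hr₂, h₂⟩ := hc 0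
  set L := ‖laplacian‖ with hL
  have hL0 : 0 ≤ L := norm_nonneg _
  refine ⟨min (min r₁ r₂) (δ / 2 / (L + 1)), by positivity, fun ε hε hεr U hU => ?_⟩
  have hεL : ‖(ε : ℂ) • laplacian‖ ≤ δ / 2 := by
    rw [norm_smul, Complex.norm_real, Real.norm_eq_abs, abs_of_pos hε]
    have h3 := hεr.trans (min_le_right _ _)
    rw [le_div_iff₀ (by positivity)] at h3
    nlinarith
  have hb : ‖blockOp γ Ω E U - blockOp γ Ω E (dimerSeq z)‖ ≤ δ / 2 := by
    refine norm_blockOp_sub_le γ Ω E U _ (by positivity) fun n => ?_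
    have hn : ‖U n - dimerSeq z n‖ ≤ min r₁ r₂ :=
      (lp.norm_apply_le_norm (by norm_num) (U - dimerSeq z) n).trans (hU.trans (min_le_left _ _))
    by_cases h0 : n = 0
    · subst h0
      rw [dimerSeq_zero] at hn ⊢
      exact h₁ _ (hn.trans (min_le_left _ _))
    · rw [dimerSeq_of_ne z h0] at hn ⊢
      exact h₂ _ (hn.trans (min_le_right _ _))
  have : hessian γ Ω E ε U - blockOp γ Ω E (dimerSeq z) =
      (blockOp γ Ω E U - blockOp γ Ω E (dimerSeq z)) + (ε : ℂ) • laplacian := by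
    rw [hessian]; abel
  rw [this]
  exact (norm_add_le _ _).trans (by linarith)

theorem gaugeMode_star_apply (U : Seq) (n : ℤ) :
    gaugeMode U (star U) n = !₂[U n, -conj (U n), conj (U n), -U n] := by
  have h : gaugeMode U (star U) n = !₂[U n, -conj (U n), conj (U n), -conj (conj (U n))] := rfl
  rw [h, Complex.conj_conj]

/-- The gauge mode is in the kernel of the Hessian. -/
theorem hessian_gaugeMode {γ Ω E ε : ℝ} {U : Seq} (hU : IsBreather γ Ω E ε U) :
    hessian γ Ω E ε U (gaugeMode U (star U)) = 0 := by
  ext1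
  funext n
  have h1 := hU.stationary n
  rw [hessian_apply, gaugeMode_star_apply, gaugeMode_star_apply, gaugeMode_star_apply]
  change _ = (0 : EuclideanSpace ℂ (Fin 4))
  generalize hu : (U n : ℂ) = u at *
  generalize hu' : (U (n + 1) : ℂ) = u' at *
  generalize hu'' : (U (n - 1) : ℂ) = u'' at *
  -- Up to sign, the four components are the stationary equation and its conjugate.
  have h2 := congrArg conj h1
  simp only [map_sub, map_mul, map_add, map_pow, Complex.conj_conj,
      Complex.conj_ofReal, Complex.conj_I, Complex.conj_ofNat] at h2
  have h3 : (‖u‖ : ℂ) ^ 2 = u * conj u := by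
    rw [Complex.mul_conj, Complex.normSq_eq_norm_sq]; push_cast; rfl
  rw [h3] at h1 h2
  ext i
  fin_cases i <;> simp [blockCLM, block, h3]
  · linear_combination -h2
  · linear_combination h1
  · linear_combination -h1
  · linear_combination h2

/-! ### Existence and local uniqueness of breathers -/

/-- The translate of a scalar sequence. -/
noncomputable def shiftSeq (k : ℤ) (U : Seq) : Seq :=
  ⟨fun n => U (n + k), memℓp_gen (((lp.memℓp U).summable (by norm_num)).comp_injective
    (add_left_injective k))⟩

theorem norm_shiftSeq (k : ℤ) (U : Seq) : ‖shiftSeq k U‖ = ‖U‖ := by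
  rw [lp.norm_eq_tsum_rpow (by norm_num), lp.norm_eq_tsum_rpow (by norm_num)]
  refine congrArg (fun x : ℝ => x ^ (1 / (2 : ENNReal).toReal)) ?_
  exact (Equiv.addRight k).tsum_eq (fun n => ‖U n‖ ^ (2 : ENNReal).toReal)

/-- The sequence of absolute values. -/
noncomputable def absSeq (U : Seq) : Seq :=
  ⟨fun n => (‖U n‖ : ℂ), memℓp_gen (by simpa using (lp.memℓp U).summable (by norm_num))⟩

theorem norm_absSeq (U : Seq) : ‖absSeq U‖ = ‖U‖ := by
  rw [lp.norm_eq_tsum_rpow (by norm_num), lp.norm_eq_tsum_rpow (by norm_num)]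
  simp [absSeq]

/-- A sequence dominated by nearest-neighbour averages of a square summable one. -/
theorem memlp_of_nearest_neighbour_bound (X : ℤ → ℂ) (Y : Seq) {a b : ℝ} (ha : 0 ≤ a) (hb : 0 ≤ b)
    (h : ∀ n, ‖X n‖ ≤ a * ‖Y n‖ + b * (‖Y (n + 1)‖ + 2 * ‖Y n‖ + ‖Y (n - 1)‖)) :
    ∃ hX : Memℓp X 2, ‖(⟨X, hX⟩ : Seq)‖ ≤ (a + 4 * b) * ‖Y‖ := by
  set W : Seq := (a : ℂ) • absSeq Y + (b : ℂ) •
    (shiftSeq 1 (absSeq Y) + (2 : ℂ) • absSeq Y + shiftSeq (-1) (absSeq Y)) with hW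
  have hWn : ∀ n, W n = ((a * ‖Y n‖ + b * (‖Y (n + 1)‖ + 2 * ‖Y n‖ + ‖Y (n - 1)‖) : ℝ) : ℂ) := by
    intro n
    push_cast
    rfl
  have hXW : ∀ n, ‖X n‖ ≤ ‖W n‖ := by
    intro n
    rw [hWn, Complex.norm_real, Real.norm_eq_abs, abs_of_nonneg (by positivity)]
    exact h n
  have hX : Memℓp X 2 := (lp.memℓp W).norm.mono (fun n => by simpa using hXW n)
  refine ⟨hX, (lp.norm_mono (by norm_num) (x := (⟨X, hX⟩ : Seq)) (y := W) hXW).trans ?_⟩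
  have h1 : ‖W‖ ≤ a * ‖Y‖ + b * (‖Y‖ + 2 * ‖Y‖ + ‖Y‖) := by
    refine (norm_add_le _ _).trans ?_
    rw [norm_smul, norm_smul, Complex.norm_real, Complex.norm_real, Real.norm_of_nonneg ha,
      Real.norm_of_nonneg hb, norm_absSeq]
    gcongr
    refine (norm_add_le _ _).trans ?_
    rw [norm_shiftSeq, norm_absSeq]
    gcongr
    refine (norm_add_le _ _).trans ?_
    rw [norm_shiftSeq, norm_absSeq, norm_smul, norm_absSeq]
    simp
  linarith

/-- The coupling term of the stationary equation. -/
noncomputable def coupling (U : Seq) (n : ℤ) : ℂ :=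
  conj (U (n + 1)) - 2 * conj (U n) + conj (U (n - 1))

theorem coupling_sub (U V : Seq) (n : ℤ) :
    coupling (U - V) n = coupling U n - coupling V n := by
  simp only [coupling, lp.coeFn_sub, Pi.sub_apply, map_sub]
  ring

theorem norm_coupling_le (U : Seq) (n : ℤ) :
    ‖coupling U n‖ ≤ ‖U (n + 1)‖ + 2 * ‖U n‖ + ‖U (n - 1)‖ := by
  refine (norm_add_le _ _).trans (add_le_add ((norm_sub_le _ _).trans ?_) ?_)
  all_goals simp

/-! ### Contraction of the simplified Newton map -/

section Contraction

variable {g : ℂ → ℂ} {e : ℤ → ℂ ≃L[ℝ] ℂ} {w : Seq} {K r ε : ℝ}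

/-- One step of the simplified Newton method. -/
noncomputable def newtonStep (g : ℂ → ℂ) (e : ℤ → ℂ ≃L[ℝ] ℂ) (ε : ℝ) (U : Seq) (n : ℤ) : ℂ :=
  U n - (e n).symm (g (U n) - ε * coupling U n)

theorem norm_symm_coupling_le (hK0 : 0 ≤ K) (hK : ∀ n x, ‖(e n).symm x‖ ≤ K * ‖x‖) (hε : 0 ≤ ε)
    (U : Seq) (n : ℤ) : ‖(e n).symm (ε * coupling U n)‖ ≤
      K * ε * (‖U (n + 1)‖ + 2 * ‖U n‖ + ‖U (n - 1)‖) := by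
  refine (hK n _).trans ?_
  rw [norm_mul, Complex.norm_real, Real.norm_of_nonneg hε, ← mul_assoc]
  gcongr
  exact norm_coupling_le U n

theorem memlp_newtonStep (hK0 : 0 ≤ K) (hK : ∀ n x, ‖(e n).symm x‖ ≤ K * ‖x‖) (hε : 0 ≤ ε)
    (hgrowth : ∀ R : ℝ, ∃ C, 0 ≤ C ∧ ∀ u, ‖u‖ ≤ R → ‖g u‖ ≤ C * ‖u‖) (U : Seq) :
    Memℓp (newtonStep g e ε U) 2 := by
  obtain ⟨C, hC, h⟩ := hgrowth ‖U‖
  refine (memlp_of_nearest_neighbour_bound (newtonStep g e ε U) U (a := 1 + K * C) (b := K * ε)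
    (by positivity) (by positivity) fun n => ?_).1
  rw [newtonStep, map_sub]
  have h1 := norm_symm_coupling_le hK0 hK hε U n
  have h2 : ‖(e n).symm (g (U n))‖ ≤ K * (C * ‖U n‖) :=
    (hK n _).trans (by gcongr; exact h _ (lp.norm_apply_le_norm (by norm_num) U n))
  have h3 := norm_sub_le (U n) ((e n).symm (g (U n)) - (e n).symm (ε * coupling U n))
  have h4 := norm_sub_le ((e n).symm (g (U n))) ((e n).symm (ε * coupling U n))
  linarith

/-- The simplified Newton step contracts near the anticontinuum profile. -/
theorem norm_newtonStep_sub_le (hK0 : 0 ≤ K) (hK : ∀ n x, ‖(e n).symm x‖ ≤ K * ‖x‖) (hε : 0 ≤ ε)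
    (hlip : ∀ n u u', ‖u - w n‖ ≤ r → ‖u' - w n‖ ≤ r →
      ‖(u - (e n).symm (g u)) - (u' - (e n).symm (g u'))‖ ≤ 1 / 4 * ‖u - u'‖)
    (hsmall : 16 * K * ε ≤ 1) {U V G G' : Seq} (hU : ∀ n, ‖U n - w n‖ ≤ r)
    (hV : ∀ n, ‖V n - w n‖ ≤ r) (hG : ∀ n, G n = newtonStep g e ε U n)
    (hG' : ∀ n, G' n = newtonStep g e ε V n) :
    ‖G - G'‖ ≤ 1 / 2 * ‖U - V‖ := by
  -- The total constant is `1 / 4 + 4Kε`, at most `1 / 2` by `hsmall`.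
  obtain ⟨hX, h⟩ := memlp_of_nearest_neighbour_bound (fun n => G n - G' n) (U - V) (a := 1 / 4)
    (b := K * ε) (by norm_num) (by positivity) fun n => by
      have h1 : G n - G' n = ((U n - (e n).symm (g (U n))) - (V n - (e n).symm (g (V n)))) +
          (e n).symm (ε * coupling (U - V) n) := by
        rw [hG, hG', coupling_sub, newtonStep, newtonStep, map_sub, map_sub, mul_sub, map_sub]
        ring
      rw [h1]
      exact (norm_add_le _ _).trans (add_le_add (hlip n _ _ (hU n) (hV n))
        (norm_symm_coupling_le hK0 hK hε (U - V) n))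
  refine (le_of_eq_of_le (congrArg norm ?_) h).trans ?_
  · rfl
  · gcongr
    linarith

theorem newtonStep_eq_iff {U : Seq} {n : ℤ} :
    newtonStep g e ε U n = U n ↔ g (U n) = ε * coupling U n := by
  rw [newtonStep, sub_eq_self, map_eq_zero_iff _ (e n).symm.injective, sub_eq_zero]

/-- Uniqueness needs only pointwise closeness to `w`, not closeness in `ℓ²`; this is what
`NearDimer` provides for even sequences. -/
theorem eq_of_stationary (hK0 : 0 ≤ K) (hK : ∀ n x, ‖(e n).symm x‖ ≤ K * ‖x‖) (hε : 0 ≤ ε)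
    (hlip : ∀ n u u', ‖u - w n‖ ≤ r → ‖u' - w n‖ ≤ r →
      ‖(u - (e n).symm (g u)) - (u' - (e n).symm (g u'))‖ ≤ 1 / 4 * ‖u - u'‖)
    (hsmall : 16 * K * ε ≤ 1) {U V : Seq} (hU : ∀ n, ‖U n - w n‖ ≤ r)
    (hV : ∀ n, ‖V n - w n‖ ≤ r) (hU' : ∀ n, g (U n) = ε * coupling U n)
    (hV' : ∀ n, g (V n) = ε * coupling V n) : U = V := by
  have h := norm_newtonStep_sub_le hK0 hK hε hlip hsmall hU hV
    (fun n => (newtonStep_eq_iff.2 (hU' n)).symm) (fun n => (newtonStep_eq_iff.2 (hV' n)).symm)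
  rw [← sub_eq_zero, ← norm_eq_zero]
  linarith [norm_nonneg (U - V)]

/-- Banach's fixed point theorem: the first step moves `w` by at most `4Kε‖w‖`, and the contraction
factor `1 / 2` doubles this to the final distance. -/
theorem exists_stationary (hK0 : 0 ≤ K) (hK : ∀ n x, ‖(e n).symm x‖ ≤ K * ‖x‖) (hε : 0 ≤ ε)
    (hlip : ∀ n u u', ‖u - w n‖ ≤ r → ‖u' - w n‖ ≤ r →
      ‖(u - (e n).symm (g u)) - (u' - (e n).symm (g u'))‖ ≤ 1 / 4 * ‖u - u'‖)
    (hgrowth : ∀ R : ℝ, ∃ C, 0 ≤ C ∧ ∀ u, ‖u‖ ≤ R → ‖g u‖ ≤ C * ‖u‖)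
    (hw : ∀ n, g (w n) = 0) (hsmall : 16 * K * ε ≤ 1) (hsmall' : 8 * K * ε * ‖w‖ ≤ r) :
    ∃ U : Seq, (∀ n, g (U n) = ε * coupling U n) ∧ ‖U - w‖ ≤ 8 * K * ε * ‖w‖ := by
  let G : Seq → Seq := fun U => ⟨newtonStep g e ε U, memlp_newtonStep hK0 hK hε hgrowth U⟩
  have hr : 0 ≤ r := le_trans (by positivity) hsmall'
  have hball : ∀ U ∈ Metric.closedBall w r, ∀ n, ‖U n - w n‖ ≤ r := fun U hU n =>
    (lp.norm_apply_le_norm (by norm_num) (U - w) n).trans (mem_closedBall_iff_norm.1 hU)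
  have hcon : ∀ U ∈ Metric.closedBall w r, ∀ V ∈ Metric.closedBall w r,
      ‖G U - G V‖ ≤ 1 / 2 * ‖U - V‖ := fun U hU V hV =>
    norm_newtonStep_sub_le hK0 hK hε hlip hsmall (hball U hU) (hball V hV) (fun _ => rfl)
      (fun _ => rfl)
  have hGw : ‖G w - w‖ ≤ 4 * K * ε * ‖w‖ := by
    obtain ⟨hX, h⟩ := memlp_of_nearest_neighbour_bound (fun n => G w n - w n) w (a := 0)
      (b := K * ε) le_rfl (by positivity) fun n => by
        have h1 : G w n - w n = (e n).symm (ε * coupling w n) := by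
          change newtonStep g e ε w n - w n = _
          rw [newtonStep, hw, zero_sub, map_neg]
          ring
        rw [h1, zero_mul, zero_add]
        exact norm_symm_coupling_le hK0 hK hε w n
    refine (le_of_eq_of_le (congrArg norm ?_) h).trans (le_of_eq (by ring))
    rfl
  have hwb : w ∈ Metric.closedBall w r := Metric.mem_closedBall_self hr
  have hdist : ∀ U ∈ Metric.closedBall w r, ‖G U - w‖ ≤ 1 / 2 * ‖U - w‖ + 4 * K * ε * ‖w‖ :=
    fun U hU => by
      have h1 : G U - w = (G U - G w) + (G w - w) := by abel
      rw [h1]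
      exact (norm_add_le _ _).trans (add_le_add (hcon U hU w hwb) hGw)
  have hmaps : Set.MapsTo G (Metric.closedBall w r) (Metric.closedBall w r) := fun U hU => by
    have h1 := hdist U hU
    have h2 := mem_closedBall_iff_norm.1 hU
    exact mem_closedBall_iff_norm.2 (by linarith)
  have hcw : ContractingWith (1 / 2) (hmaps.restrict G _ _) := by
    refine ⟨by norm_num, LipschitzWith.of_dist_le_mul fun U V => ?_⟩
    rw [Subtype.dist_eq, Subtype.dist_eq, dist_eq_norm, dist_eq_norm]
    simpa using hcon U U.2 V V.2
  obtain ⟨U, hU, hfix, -⟩ := hcw.exists_fixedPoint' Metric.isClosed_closedBall.isComplete hmaps hwb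
    (edist_ne_top _ _)
  refine ⟨U, fun n => newtonStep_eq_iff.1 (?_ : newtonStep g e ε U n = U n), ?_⟩
  · exact congrArg (fun W : Seq => W n) hfix
  · have h1 := hdist U hU
    rw [hfix.eq] at h1
    linarith

end Contraction

/-! ### The on-site equation and its linearization -/

/-- The real-linear map `h ↦ α h - β h̄`. -/
noncomputable def realLin (α β : ℂ) : ℂ →L[ℝ] ℂ :=
  ContinuousLinearMap.mul ℝ ℂ α - (ContinuousLinearMap.mul ℝ ℂ β).comp
    (Complex.conjCLE : ℂ →L[ℝ] ℂ)

theorem realLin_apply (α β h : ℂ) : realLin α β h = α * h - β * conj h := by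
  simp [realLin]

/-- The real determinant is `D = |α|² - |β|²`, and the inverse is `x ↦ (ᾱ x + β x̄) / D`. -/
theorem exists_equiv_realLin {α β : ℂ} (h : ‖α‖ ^ 2 ≠ ‖β‖ ^ 2) :
    ∃ e : ℂ ≃L[ℝ] ℂ, (e : ℂ →L[ℝ] ℂ) = realLin α β := by
  set D : ℝ := ‖α‖ ^ 2 - ‖β‖ ^ 2 with hD
  have hD0 : (D : ℂ) ≠ 0 := by exact_mod_cast sub_ne_zero.2 h
  have hDc : (D : ℂ) = α * conj α - β * conj β := by
    rw [Complex.mul_conj, Complex.mul_conj, Complex.normSq_eq_norm_sq, Complex.normSq_eq_norm_sq,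
      hD]
    push_cast
    rfl
  refine ⟨ContinuousLinearEquiv.equivOfInverse (realLin α β) (realLin (conj α / D) (-β / D))
    (fun x => ?_) (fun x => ?_), rfl⟩
  all_goals
    simp only [realLin_apply, map_sub, map_mul, map_div₀, map_neg, Complex.conj_conj,
      Complex.conj_ofReal]
    field_simp
    rw [hDc]
    ring

/-- The on-site part of the stationary equation. -/
noncomputable def onsite (γ Ω E : ℝ) (u : ℂ) : ℂ :=
  (E - Complex.I * γ) * u - Ω * conj u - 6 * (u * conj u * conj u) - 2 * (u * u * u)

theorem hasStrictFDerivAt_onsite (γ Ω E : ℝ) (z : ℂ) :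
    HasStrictFDerivAt (onsite γ Ω E)
      (realLin (E - Complex.I * γ - 6 * (z ^ 2 + conj z ^ 2)) (Ω + 12 * (‖z‖ : ℂ) ^ 2)) z := by
  have hc : HasStrictFDerivAt (fun u : ℂ => conj u) (Complex.conjCLE : ℂ →L[ℝ] ℂ) z :=
    Complex.conjCLE.hasStrictFDerivAt
  have hi : HasStrictFDerivAt (fun u : ℂ => u) (ContinuousLinearMap.id ℝ ℂ) z :=
    hasStrictFDerivAt_id z
  have h := (((hi.const_mul ((E : ℂ) - Complex.I * γ)).sub (hc.const_mul (Ω : ℂ))).sub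
    (((hi.mul hc).mul hc).const_mul 6)).sub (((hi.mul hi).mul hi).const_mul 2)
  have h3 : (‖z‖ : ℂ) ^ 2 = z * conj z := by
    rw [Complex.mul_conj, Complex.normSq_eq_norm_sq]; push_cast; rfl
  refine h.congr_fderiv ?_
  ext1 x
  rw [realLin_apply, h3]
  simp
  ring

/-- The hypothesis says that the first two block eigenvalues are nonzero, which is `|α| ≠ |β|` for
the Jacobian. Strict differentiability is used because two moving points are compared. -/
theorem exists_lipschitz_newton {γ Ω E : ℝ} {z : ℂ}
    (hz : ‖symmEntry γ E z‖ ^ 2 ≠ (Ω + 12 * ‖z‖ ^ 2) ^ 2) :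
    ∃ e : ℂ ≃L[ℝ] ℂ, ∃ r > 0, ∀ u u', ‖u - z‖ ≤ r → ‖u' - z‖ ≤ r →
      ‖(u - e.symm (onsite γ Ω E u)) - (u' - e.symm (onsite γ Ω E u'))‖ ≤ 1 / 4 * ‖u - u'‖ := by
  have hα : ‖(E : ℂ) - Complex.I * γ - 6 * (z ^ 2 + conj z ^ 2)‖ = ‖symmEntry γ E z‖ := by
    rw [← RCLike.norm_conj, ← norm_neg]
    congr 1
    simp only [symmEntry, map_sub, map_mul, map_add, map_pow, Complex.conj_conj,
      Complex.conj_ofReal, Complex.conj_I, Complex.conj_ofNat]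
    ring
  have hβ : ‖(Ω : ℂ) + 12 * (‖z‖ : ℂ) ^ 2‖ ^ 2 = (Ω + 12 * ‖z‖ ^ 2) ^ 2 := by
    have : (Ω : ℂ) + 12 * (‖z‖ : ℂ) ^ 2 = ((Ω + 12 * ‖z‖ ^ 2 : ℝ) : ℂ) := by push_cast; rfl
    rw [this, Complex.norm_real, Real.norm_eq_abs, sq_abs]
  obtain ⟨e, he⟩ := exists_equiv_realLin
    (α := E - Complex.I * γ - 6 * (z ^ 2 + conj z ^ 2)) (β := Ω + 12 * (‖z‖ : ℂ) ^ 2)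
    (by rwa [hα, hβ])
  have hd := hasStrictFDerivAt_onsite γ Ω E z
  rw [← he] at hd
  set c := ‖(e.symm : ℂ →L[ℝ] ℂ)‖ with hc
  have hc0 : 0 ≤ c := norm_nonneg _
  have hev := hd.isLittleO.def (show (0 : ℝ) < 1 / 4 / (c + 1) by positivity)
  obtain ⟨r, hr, h⟩ := Metric.eventually_nhds_iff.1 hev
  refine ⟨e, r / 2, by positivity, fun u u' hu hu' => ?_⟩
  have h1 := @h (u, u') (by
    rw [Prod.dist_eq, max_lt_iff, dist_eq_norm, dist_eq_norm]
    constructor <;> dsimp only <;> linarith)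
  have h2 : (u - e.symm (onsite γ Ω E u)) - (u' - e.symm (onsite γ Ω E u')) =
      -((e.symm : ℂ →L[ℝ] ℂ) (onsite γ Ω E u - onsite γ Ω E u' - e (u - u'))) := by
    simp only [ContinuousLinearEquiv.coe_coe, map_sub, ContinuousLinearEquiv.symm_apply_apply]
    ring
  rw [h2, norm_neg]
  refine ((e.symm : ℂ →L[ℝ] ℂ).le_opNorm _).trans ?_
  have h3 : ‖onsite γ Ω E u - onsite γ Ω E u' - e (u - u')‖ ≤ 1 / 4 / (c + 1) * ‖u - u'‖ := h1
  calc c * ‖onsite γ Ω E u - onsite γ Ω E u' - e (u - u')‖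
      ≤ (c + 1) * (1 / 4 / (c + 1) * ‖u - u'‖) := by gcongr; linarith
    _ = 1 / 4 * ‖u - u'‖ := by field_simp

theorem onsite_growth (γ Ω E : ℝ) (R : ℝ) :
    ∃ C, 0 ≤ C ∧ ∀ u, ‖u‖ ≤ R → ‖onsite γ Ω E u‖ ≤ C * ‖u‖ := by
  refine ⟨‖(E : ℂ) - Complex.I * γ‖ + ‖(Ω : ℂ)‖ + 8 * R ^ 2, by positivity, fun u hu => ?_⟩
  have h0 := norm_nonneg u
  have h1 : ‖u‖ * ‖u‖ ≤ R ^ 2 := by nlinarith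
  have h2 : ‖u‖ * ‖u‖ * ‖u‖ ≤ R ^ 2 * ‖u‖ := by gcongr
  rw [onsite]
  refine (norm_sub_le _ _).trans ?_
  have h3 := norm_sub_le ((E - Complex.I * γ) * u - Ω * conj u) (6 * (u * conj u * conj u))
  have h4 := norm_sub_le ((E - Complex.I * γ) * u) (Ω * conj u)
  simp only [norm_mul, RCLike.norm_conj, RCLike.norm_ofNat] at *
  linarith

theorem stationary_iff (γ Ω E ε : ℝ) (U : Seq) (n : ℤ) :
    ((E : ℂ) * U n = ε * (conj (U (n + 1)) - 2 * conj (U n) + conj (U (n - 1))) + Ω * conj (U n)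
      + Complex.I * γ * U n + 6 * (‖U n‖ : ℂ) ^ 2 * conj (U n) + 2 * U n ^ 3) ↔
    onsite γ Ω E (U n) = ε * coupling U n := by
  have h3 : (‖U n‖ : ℂ) ^ 2 = U n * conj (U n) := by
    rw [Complex.mul_conj, Complex.normSq_eq_norm_sq]; push_cast; rfl
  rw [h3, onsite, coupling]
  constructor <;> intro h <;> linear_combination h

theorem norm_dimerSeq (z : ℂ) : ‖dimerSeq z‖ = ‖z‖ :=
  lp.norm_single (E := fun _ : ℤ => ℂ) (p := 2) two_pos 0 z

theorem dimerSeq_neg (z : ℂ) (n : ℤ) : dimerSeq z (-n) = dimerSeq z n := by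
  by_cases hn : n = 0
  · simp [hn]
  · rw [dimerSeq_of_ne z hn, dimerSeq_of_ne z (neg_ne_zero.2 hn)]

theorem nearDimer_of_norm_sub_le {z : ℂ} {C ε s : ℝ} {U : Seq} (h : ‖U - dimerSeq z‖ ≤ s)
    (hs : 2 * s ≤ C * |ε|) : NearDimer z C ε U := by
  have hUn : ∀ n, ‖U n - dimerSeq z n‖ ≤ s := fun n =>
    (lp.norm_apply_le_norm (by norm_num) (U - dimerSeq z) n).trans h
  have h0 := hUn 0
  rw [dimerSeq_zero] at h0
  have h1 : (⨆ n : ℕ, ‖U ((n : ℤ) + 1)‖) ≤ s := by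
    refine ciSup_le fun n => ?_
    have := hUn ((n : ℤ) + 1)
    rwa [dimerSeq_of_ne z (by positivity), sub_zero] at this
  rw [NearDimer]
  linarith

theorem norm_sub_dimerSeq_le_of_nearDimer {z : ℂ} {C ε r : ℝ} {U : Seq}
    (hsymm : ∀ n, U (-n) = U n) (h : NearDimer z C ε U) (hr : C * |ε| ≤ r) (n : ℤ) :
    ‖U n - dimerSeq z n‖ ≤ r := by
  rw [NearDimer] at h
  have hbdd : BddAbove (Set.range fun n : ℕ => ‖U ((n : ℤ) + 1)‖) := by
    refine ⟨‖U‖, ?_⟩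
    rintro _ ⟨n, rfl⟩
    exact lp.norm_apply_le_norm (by norm_num) U _
  have hsup0 : 0 ≤ ⨆ n : ℕ, ‖U ((n : ℤ) + 1)‖ := Real.iSup_nonneg fun _ => norm_nonneg _
  have hpt : ∀ n : ℤ, 0 < n → ‖U n - dimerSeq z n‖ ≤ r := fun n hn => by
    rw [dimerSeq_of_ne z hn.ne', sub_zero]
    obtain ⟨m, hm⟩ := Int.eq_ofNat_of_zero_le (show 0 ≤ n - 1 by omega)
    rw [show n = (m : ℤ) + 1 by omega]
    have := le_ciSup hbdd m
    have := norm_nonneg (U 0 - z)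
    linarith
  rcases lt_trichotomy n 0 with hn | rfl | hn
  · rw [← hsymm n, ← dimerSeq_neg]
    exact hpt _ (neg_pos.2 hn)
  · rw [dimerSeq_zero]
    linarith
  · exact hpt n hn

/-- The reflected sequence. -/
noncomputable def reflect (U : Seq) : Seq :=
  ⟨fun n => U (-n), memℓp_gen (((lp.memℓp U).summable (by norm_num)).comp_injective
    neg_injective)⟩

theorem reflect_apply (U : Seq) (n : ℤ) : reflect U n = U (-n) := rfl

theorem coupling_reflect (U : Seq) (n : ℤ) : coupling (reflect U) n = coupling U (-n) := by
  simp only [coupling, reflect_apply]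
  rw [show -(n + 1) = -n - 1 by ring, show -(n - 1) = -n + 1 by ring]
  ring

theorem exists_newton_data {γ Ω E : ℝ} {z : ℂ}
    (hnd : ‖symmEntry γ E z‖ ^ 2 ≠ (Ω + 12 * ‖z‖ ^ 2) ^ 2)
    (hnd0 : ‖symmEntry γ E 0‖ ^ 2 ≠ Ω ^ 2) :
    ∃ e : ℤ → ℂ ≃L[ℝ] ℂ, ∃ K > 0, ∃ r > 0, (∀ n x, ‖(e n).symm x‖ ≤ K * ‖x‖) ∧
      ∀ n u u', ‖u - dimerSeq z n‖ ≤ r → ‖u' - dimerSeq z n‖ ≤ r →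
        ‖(u - (e n).symm (onsite γ Ω E u)) - (u' - (e n).symm (onsite γ Ω E u'))‖ ≤
          1 / 4 * ‖u - u'‖ := by
  obtain ⟨e₀, r₀, hr₀, hl₀⟩ := exists_lipschitz_newton hnd
  obtain ⟨e₁, r₁, hr₁, hl₁⟩ := exists_lipschitz_newton (γ := γ) (Ω := Ω) (E := E) (z := 0)
    (by simpa using hnd0)
  refine ⟨fun n => if n = 0 then e₀ else e₁,
    ‖(e₀.symm : ℂ →L[ℝ] ℂ)‖ + ‖(e₁.symm : ℂ →L[ℝ] ℂ)‖ + 1, by positivity, min r₀ r₁,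
    lt_min hr₀ hr₁, fun n x => ?_, fun n u u' hu hu' => ?_⟩
  · by_cases hn : n = 0
    · simp only [hn, if_true]
      refine ((e₀.symm : ℂ →L[ℝ] ℂ).le_opNorm x).trans ?_
      gcongr
      linarith [norm_nonneg (e₁.symm : ℂ →L[ℝ] ℂ)]
    · simp only [hn, if_false]
      refine ((e₁.symm : ℂ →L[ℝ] ℂ).le_opNorm x).trans ?_
      gcongr
      linarith [norm_nonneg (e₀.symm : ℂ →L[ℝ] ℂ)]
  · by_cases hn : n = 0
    · subst hn
      rw [dimerSeq_zero] at hu hu'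
      exact hl₀ u u' (hu.trans (min_le_left _ _)) (hu'.trans (min_le_left _ _))
    · rw [dimerSeq_of_ne z hn] at hu hu'
      simp only [hn, if_false]
      exact hl₁ u u' (hu.trans (min_le_right _ _)) (hu'.trans (min_le_right _ _))

/-- Breathers near the anticontinuum limit exist and are locally unique. -/
theorem exists_unique_breather {γ Ω E : ℝ} {z : ℂ} (hz0 : z ≠ 0) (hz : onsite γ Ω E z = 0)
    (hnd : ‖symmEntry γ E z‖ ^ 2 ≠ (Ω + 12 * ‖z‖ ^ 2) ^ 2)
    (hnd0 : ‖symmEntry γ E 0‖ ^ 2 ≠ Ω ^ 2) :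
    ∃ C₀ > 0, ∀ ρ > 0, ∃ ε₀ > 0, ∀ ε : ℝ, 0 < ε → ε < ε₀ →
      ∃ U : Seq, IsBreather γ Ω E ε U ∧ NearDimer z C₀ ε U ∧
        (∀ U' : Seq, IsBreather γ Ω E ε U' → NearDimer z C₀ ε U' → U' = U) ∧
        ‖U - dimerSeq z‖ ≤ ρ := by
  obtain ⟨e, K, hK0, r, hr0, hK, hlip⟩ := exists_newton_data hnd hnd0
  have hw0 : ∀ n, onsite γ Ω E (dimerSeq z n) = 0 := fun n => by
    by_cases hn : n = 0
    · subst hn; rwa [dimerSeq_zero]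
    · rw [dimerSeq_of_ne z hn]; simp [onsite]
  have hzn : 0 < ‖z‖ := norm_pos_iff.2 hz0
  -- The `ℓ²` distance is at most `8Kε‖z‖`; `NearDimer` adds two terms, each bounded by it.
  refine ⟨16 * K * ‖z‖, by positivity, fun ρ hρ => ?_⟩
  refine ⟨min (1 / (16 * K)) (min (r / (16 * K * ‖z‖)) (ρ / (16 * K * ‖z‖))), by positivity,
    fun ε hε hεs => ?_⟩
  rw [lt_min_iff, lt_min_iff, lt_div_iff₀ (by positivity), lt_div_iff₀ (by positivity),
    lt_div_iff₀ (by positivity)] at hεs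
  obtain ⟨hs₁, hs₂, hs₃⟩ := hεs
  have hs₁' : 16 * K * ε ≤ 1 := by linarith
  have hpos : 0 < K * ε * ‖z‖ := by positivity
  obtain ⟨U, hU, hUw⟩ := exists_stationary hK0.le hK hε.le hlip (onsite_growth γ Ω E) hw0
    hs₁' (by rw [norm_dimerSeq]; linarith)
  rw [norm_dimerSeq] at hUw
  have hUr : ∀ n, ‖U n - dimerSeq z n‖ ≤ r := fun n =>
    (lp.norm_apply_le_norm (by norm_num) (U - dimerSeq z) n).trans (by linarith)
  have huniq : ∀ V : Seq, (∀ n, ‖V n - dimerSeq z n‖ ≤ r) →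
      (∀ n, onsite γ Ω E (V n) = ε * coupling V n) → V = U := fun V hV hV' =>
    eq_of_stationary hK0.le hK hε.le hlip hs₁' hV hUr hV' hU
  -- The reflected sequence solves the same equation near the same even profile, so evenness follows
  -- from uniqueness.
  have hrefl : reflect U = U := by
    refine huniq (reflect U) (fun n => ?_) fun n => ?_
    · rw [← dimerSeq_neg]
      exact hUr (-n)
    · rw [coupling_reflect]
      exact hU (-n)
  refine ⟨U, ⟨fun n => (stationary_iff γ Ω E ε U n).2 (hU n), fun n => ?_⟩, ?_, ?_, by linarith⟩
  · rw [← reflect_apply, hrefl]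
  · refine nearDimer_of_norm_sub_le hUw ?_
    rw [abs_of_pos hε]
    linarith
  · intro U' hU' hnear
    refine huniq U' (norm_sub_dimerSeq_le_of_nearDimer hU'.symmetric hnear ?_)
      (fun n => (stationary_iff γ Ω E ε U' n).1 (hU'.stationary n))
    rw [abs_of_pos hε]
    linarith

/-! ### Solutions of the dimer equation -/

theorem norm_polar {A : ℝ} (hA : 0 < A) (θ : ℝ) : ‖polar A θ‖ = A := by
  rw [polar, norm_mul, mul_comm Complex.I, Complex.norm_exp_ofReal_mul_I, Complex.norm_real,
    Real.norm_of_nonneg hA.le, mul_one]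

theorem onsite_eq_zero_of_isDimer {γ Ω E : ℝ} {z : ℂ} (h : IsDimer γ Ω E z) :
    onsite γ Ω E z = 0 := by
  have h3 : (‖z‖ : ℂ) ^ 2 = z * conj z := by
    rw [Complex.mul_conj, Complex.normSq_eq_norm_sq]; push_cast; rfl
  rw [IsDimer, h3] at h
  rw [onsite]
  linear_combination h

/-- The dimer equation in polar coordinates. -/
theorem exists_cos_sin_of_isDimer {γ Ω E A θ : ℝ} (hA : 0 < A) (h : IsDimer γ Ω E (polar A θ)) :
    ∃ C S : ℝ, C ^ 2 + S ^ 2 = 1 ∧ E = (Ω + 8 * A ^ 2) * C ∧ γ = (Ω + 4 * A ^ 2) * S ∧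
      polar A θ ^ 2 + conj (polar A θ) ^ 2 = ((2 * A ^ 2 * C : ℝ) : ℂ) := by
  obtain ⟨c, s, hcs, hz⟩ : ∃ c s : ℝ, c ^ 2 + s ^ 2 = 1 ∧ polar A θ = ⟨A * c, A * s⟩ := by
    refine ⟨Real.cos θ, Real.sin θ, Real.cos_sq_add_sin_sq θ, ?_⟩
    rw [polar, mul_comm Complex.I, Complex.exp_mul_I]
    apply Complex.ext <;> simp [Complex.cos_ofReal_re, Complex.sin_ofReal_re]
  rw [IsDimer, norm_polar hA, hz] at h
  have hre := congrArg Complex.re h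
  have him := congrArg Complex.im h
  simp [pow_succ] at hre him
  -- These are `cos 2θ` and `sin 2θ`; multiplying the equation by `e^{-iθ}` separates `E` and `γ`.
  refine ⟨c ^ 2 - s ^ 2, 2 * (c * s), ?_, ?_, ?_, ?_⟩
  · linear_combination (c ^ 2 + s ^ 2 + 1) * hcs
  · refine mul_left_cancel₀ hA.ne' ?_
    linear_combination c * hre + s * him + (-(A * E) + 2 * A ^ 3 * (c ^ 2 - s ^ 2)) * hcs
  · refine mul_left_cancel₀ hA.ne' ?_
    linear_combination s * hre - c * him + (-(A * γ) - 4 * A ^ 3 * (c * s)) * hcs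
  · rw [hz]
    apply Complex.ext <;> simp [pow_succ] <;> ring

theorem norm_sq_add_I_mul (x y : ℝ) : ‖(x : ℂ) + Complex.I * y‖ ^ 2 = x ^ 2 + y ^ 2 := by
  rw [← Complex.normSq_eq_norm_sq, Complex.normSq_apply]
  simp
  ring

/-- Both off-diagonal entries have modulus `ρ = √(E² + γ²)`, so comparing `ρ` with `|Ω|` amounts to
comparing `|E|` with `E₀`. -/
theorem blockEigenvalue_zero (γ Ω E : ℝ) :
    ∃ ρ : ℝ, 0 ≤ ρ ∧ ρ ^ 2 = E ^ 2 + γ ^ 2 ∧ ‖symmEntry γ E 0‖ = ρ ∧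
      blockEigenvalue γ Ω E 0 = ![Ω + ρ, Ω - ρ, Ω + ρ, Ω - ρ] := by
  have h1 : symmEntry γ E 0 = -antiEntry γ E 0 := by
    simp [symmEntry, antiEntry]; ring
  have h2 : antiEntry γ E 0 = (E : ℂ) + Complex.I * γ := by simp [antiEntry]
  refine ⟨‖antiEntry γ E 0‖, norm_nonneg _, ?_, ?_, ?_⟩
  · rw [h2, norm_sq_add_I_mul]
  · rw [h1, norm_neg]
  · rw [blockEigenvalue, h1, norm_neg]
    simp

/-- The eigenvalues of the block at a solution of the dimer equation. -/
theorem blockEigenvalue_dimer {γ Ω E A θ : ℝ} (hγ : γ ≠ 0) (hA : 0 < A)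
    (h : IsDimer γ Ω E (polar A θ)) :
    ∃ R : ℝ, 0 < R ∧ ‖symmEntry γ E (polar A θ)‖ = R ∧
      (Ω ≠ 0 → R ≠ |4 * A ^ 2 - Ω|) ∧
      ((Ω + 12 * A ^ 2) ^ 2 - R ^ 2) * (Ω + 4 * A ^ 2) ^ 2 =
        16 * A ^ 2 * (2 * (Ω + 4 * A ^ 2) ^ 3 - Ω * γ ^ 2) ∧
      blockEigenvalue γ Ω E (polar A θ) = ![Ω + 12 * A ^ 2 + R, Ω + 12 * A ^ 2 - R,
        Ω + 4 * A ^ 2 + |Ω + 4 * A ^ 2|, Ω + 4 * A ^ 2 - |Ω + 4 * A ^ 2|] := by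
  obtain ⟨C, S, hCS, hE, hγS, hz⟩ := exists_cos_sin_of_isDimer hA h
  have hp : symmEntry γ E (polar A θ) = ((12 * A ^ 2 * C - E : ℝ) : ℂ) + Complex.I * (-γ : ℝ) := by
    rw [symmEntry, hz]; push_cast; ring
  have hq : antiEntry γ E (polar A θ) = ((E - 4 * A ^ 2 * C : ℝ) : ℂ) + Complex.I * γ := by
    rw [antiEntry, hz]; push_cast; ring
  have hp2 := norm_sq_add_I_mul (12 * A ^ 2 * C - E) (-γ)
  have hq2 := norm_sq_add_I_mul (E - 4 * A ^ 2 * C) γ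
  rw [← hp] at hp2
  rw [← hq] at hq2
  have hS : S ≠ 0 := fun h0 => hγ (by rw [hγS, h0, mul_zero])
  -- This equality of moduli produces the zero eigenvalue.
  have hqn : ‖antiEntry γ E (polar A θ)‖ = |Ω + 4 * A ^ 2| := by
    refine (pow_left_inj₀ (norm_nonneg _) (abs_nonneg _) two_ne_zero).1 ?_
    rw [hq2, sq_abs, hE, hγS]
    linear_combination (Ω + 4 * A ^ 2) ^ 2 * hCS
  set R := ‖symmEntry γ E (polar A θ)‖ with hR
  have hR2 : R ^ 2 = (4 * A ^ 2 - Ω) ^ 2 * C ^ 2 + γ ^ 2 := by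
    rw [hp2, hE]; ring
  have hγ2 : 0 < γ ^ 2 := by positivity
  have hRpos : 0 < R := by
    refine lt_of_le_of_ne (norm_nonneg _) fun h0 => ?_
    rw [← h0] at hR2
    nlinarith [mul_nonneg (sq_nonneg (4 * A ^ 2 - Ω)) (sq_nonneg C)]
  refine ⟨R, hRpos, rfl, fun hΩ hRe => ?_, ?_, ?_⟩
  · rw [hRe, sq_abs, hγS] at hR2
    have h1 : S ^ 2 * (16 * A ^ 2 * Ω) = 0 := by
      linear_combination -hR2 - (4 * A ^ 2 - Ω) ^ 2 * hCS
    exact absurd h1 (by positivity)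
  · rw [hR2, hγS]
    linear_combination (-(4 * A ^ 2 - Ω) ^ 2 * (Ω + 4 * A ^ 2) ^ 2) * hCS
  · rw [blockEigenvalue, hqn, norm_polar hA, ← hR]

/-- The first two eigenvalues have positive product by `hsign` and positive sum `2(Ω + 12A²)`. -/
theorem pos_pos_pos_zero_of_upper_branch {γ Ω E A θ : ℝ} (hγ : γ ≠ 0) (hA : 0 < A)
    (h : IsDimer γ Ω E (polar A θ)) (hΩ : 0 < Ω + 4 * A ^ 2)
    (hsign : 0 < 2 * (Ω + 4 * A ^ 2) ^ 3 - Ω * γ ^ 2) :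
    0 < blockEigenvalue γ Ω E (polar A θ) 0 ∧ 0 < blockEigenvalue γ Ω E (polar A θ) 1 ∧
      0 < blockEigenvalue γ Ω E (polar A θ) 2 ∧ blockEigenvalue γ Ω E (polar A θ) 3 = 0 := by
  obtain ⟨R, hR, -, -, hK, hev⟩ := blockEigenvalue_dimer hγ hA h
  have hA2 : 0 < A ^ 2 := by positivity
  have h1 : 0 < ((Ω + 12 * A ^ 2) ^ 2 - R ^ 2) * (Ω + 4 * A ^ 2) ^ 2 := by rw [hK]; positivity
  have h2 : 0 < (Ω + 12 * A ^ 2) ^ 2 - R ^ 2 := pos_of_mul_pos_left h1 (by positivity)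
  have h3 : R < Ω + 12 * A ^ 2 := abs_lt_of_sq_lt_sq' (by linarith) (by linarith) |>.2
  rw [hev, abs_of_pos hΩ]
  simp only [Matrix.cons_val]
  refine ⟨by linarith, by linarith, by linarith, by ring⟩

theorem upper_branch_of_onBranchA {γ Ω E A θ : ℝ} (h : OnBranchA γ Ω E A θ) :
    0 < Ω + 4 * A ^ 2 ∧ 0 < 2 * (Ω + 4 * A ^ 2) ^ 3 - Ω * γ ^ 2 := by
  obtain ⟨h1, hA, -⟩ := h
  have hΩ : 0 < Ω := (abs_nonneg γ).trans_lt h1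
  have hg : γ ^ 2 < Ω ^ 2 := sq_lt_sq' (by linarith [neg_abs_le γ]) (by linarith [le_abs_self γ])
  have h2 : Ω ^ 3 ≤ (Ω + 4 * A ^ 2) ^ 3 := by gcongr; linarith [sq_nonneg A]
  exact ⟨by positivity, by nlinarith [pow_pos hΩ 3]⟩

theorem upper_branch_of_onBranchB {γ Ω E A θ : ℝ} (hγ : γ ≠ 0) (hγΩ : |γ| < |Ω|)
    (h : OnBranchB γ Ω E A θ) :
    Ω < 0 ∧ 0 < Ω + 4 * A ^ 2 ∧ 0 < 2 * (Ω + 4 * A ^ 2) ^ 3 - Ω * γ ^ 2 := by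
  obtain ⟨h1, hA, h2, -⟩ := h
  have hg : 0 < |γ| := abs_pos.2 hγ
  have hΩ : Ω < 0 := by
    by_contra! h0
    rw [abs_of_nonneg h0] at hγΩ
    linarith
  have h3 : 0 < Ω + 4 * A ^ 2 := by linarith
  have h4 : 0 < γ ^ 2 := by positivity
  exact ⟨hΩ, h3, by nlinarith [pow_pos h3 3, mul_pos (neg_pos.2 hΩ) h4]⟩

/-- The first two differ by `2R > 0`. Equality of the first and third would need `R = Ω - 4A² < 0`,
and of the second and third `R = 4A² - Ω`, which is excluded as `Ω sin 2θ ≠ 0`. -/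
theorem distinct_of_onBranchB {γ Ω E A θ : ℝ} (hγ : γ ≠ 0) (hγΩ : |γ| < |Ω|)
    (h : OnBranchB γ Ω E A θ) :
    blockEigenvalue γ Ω E (polar A θ) 0 ≠ blockEigenvalue γ Ω E (polar A θ) 1 ∧
      blockEigenvalue γ Ω E (polar A θ) 0 ≠ blockEigenvalue γ Ω E (polar A θ) 2 ∧
      blockEigenvalue γ Ω E (polar A θ) 1 ≠ blockEigenvalue γ Ω E (polar A θ) 2 := by
  obtain ⟨hΩ, h1, -⟩ := upper_branch_of_onBranchB hγ hγΩ h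
  have hA := h.2.1
  obtain ⟨R, hR, -, hRne, -, hev⟩ := blockEigenvalue_dimer hγ hA h.2.2.2
  have hA2 : 0 < A ^ 2 := by positivity
  have hRne := hRne hΩ.ne
  rw [abs_of_pos (by linarith)] at hRne
  rw [hev, abs_of_pos h1]
  simp only [Matrix.cons_val]
  refine ⟨fun h => ?_, fun h => ?_, fun h => hRne ?_⟩ <;> linarith

/-- Put `s = -(Ω + 4A²)` and `p = -Ω`. The two amplitude bounds are `s ≥ |γ|` and `p ≤ 2s`, whence
`pγ² ≤ 2s³`. The inequality is strict because equality forces `p = 2|γ|`. Hence `R > |Ω + 12A²|`,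
and the first pair has opposite signs. -/
theorem pos_neg_zero_neg_of_onBranchC {γ Ω E A θ : ℝ} (hγ : γ ≠ 0) (hΩ : Ω ≠ -2 * |γ|)
    (h : OnBranchC γ Ω E A θ) :
    0 < blockEigenvalue γ Ω E (polar A θ) 0 ∧ blockEigenvalue γ Ω E (polar A θ) 1 < 0 ∧
      blockEigenvalue γ Ω E (polar A θ) 2 = 0 ∧ blockEigenvalue γ Ω E (polar A θ) 3 < 0 := by
  obtain ⟨h1, hA, h2, hd⟩ := h
  obtain ⟨R, hR, -, -, hK, hev⟩ := blockEigenvalue_dimer hγ hA hd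
  have hg : 0 < |γ| := abs_pos.2 hγ
  have hA2 : 0 < A ^ 2 := by positivity
  rw [abs_of_neg (by linarith : Ω < 0), le_min_iff] at h2
  obtain ⟨h3, h4⟩ := h2
  obtain ⟨s, hs⟩ : ∃ s, s = -(Ω + 4 * A ^ 2) := ⟨_, rfl⟩
  obtain ⟨p, hp⟩ : ∃ p, p = -Ω := ⟨_, rfl⟩
  have hsγ : |γ| ≤ s := by linarith
  have hsp : p ≤ 2 * s := by linarith
  have hsign : p * γ ^ 2 < 2 * s ^ 3 := by
    rw [← sq_abs γ]
    have h5 : p * |γ| ^ 2 ≤ 2 * s * |γ| ^ 2 := by gcongr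
    have h6 : 2 * s * |γ| ^ 2 ≤ 2 * s * s ^ 2 := by gcongr; linarith
    refine lt_of_le_of_ne (by linarith [pow_succ s 2]) fun heq => ?_
    have h7 : p = 2 * s := by
      have : (2 * s - p) * |γ| ^ 2 = 0 := by linarith [pow_succ s 2]
      have := (mul_eq_zero.1 this).resolve_right (by positivity)
      linarith
    have h8 : |γ| = s := by
      have hs0 : 0 < s := by linarith
      have : 2 * s * (s ^ 2 - |γ| ^ 2) = 0 := by linarith [pow_succ s 2]
      have := (mul_eq_zero.1 this).resolve_left (by positivity)
      exact (pow_left_inj₀ hg.le hs0.le two_ne_zero).1 (by linarith)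
    exact hΩ (by linarith)
  have hs2 : 0 < (Ω + 4 * A ^ 2) ^ 2 := by
    have : Ω + 4 * A ^ 2 ≠ 0 := by linarith
    positivity
  have h5 : ((Ω + 12 * A ^ 2) ^ 2 - R ^ 2) * (Ω + 4 * A ^ 2) ^ 2 < 0 := by
    rw [hK]
    refine mul_neg_of_pos_of_neg (by positivity) ?_
    have e1 : Ω + 4 * A ^ 2 = -s := by linarith
    have e2 : Ω = -p := by linarith
    rw [e1, e2]
    linarith [show (-s) ^ 3 = -s ^ 3 by ring]
  have h6 : (Ω + 12 * A ^ 2) ^ 2 - R ^ 2 < 0 := neg_of_mul_neg_left h5 hs2.le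
  obtain ⟨h7, h8⟩ := abs_lt_of_sq_lt_sq' (by linarith : (Ω + 12 * A ^ 2) ^ 2 < R ^ 2) hR.le
  rw [hev, abs_of_neg (by linarith : Ω + 4 * A ^ 2 < 0)]
  simp only [Matrix.cons_val]
  refine ⟨by linarith, by linarith, by ring, by linarith⟩

/-! ### The breather and its Hessian -/

theorem E0_sq {γ Ω : ℝ} (h : |γ| < |Ω|) : E0 γ Ω ^ 2 = Ω ^ 2 - γ ^ 2 :=
  Real.sq_sqrt (by linarith [sq_lt_sq.2 h])

theorem infinite_preimage_of_ne_zero (p : ℤ × Fin 4 → Prop) (i : Fin 4)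
    (h : ∀ n : ℤ, n ≠ 0 → p (n, i)) : {k | p k}.Infinite := by
  refine Set.infinite_of_injective_forall_mem (f := fun m : ℕ => (((m : ℤ) + 1, i) : ℤ × Fin 4))
    (fun a b hab => ?_) fun m => h _ (by positivity)
  simpa using hab

/-- The eigenvalues of the Hessian in the anticontinuum limit. -/
noncomputable def limitEigenvalue (γ Ω E : ℝ) (z : ℂ) (k : ℤ × Fin 4) : ℝ :=
  blockEigenvalue γ Ω E (dimerSeq z k.1) k.2

theorem limitEigenvalue_zero (γ Ω E : ℝ) (z : ℂ) (i : Fin 4) :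
    limitEigenvalue γ Ω E z (0, i) = blockEigenvalue γ Ω E z i := by
  rw [limitEigenvalue, dimerSeq_zero]

theorem limitEigenvalue_of_ne (γ Ω E : ℝ) (z : ℂ) {n : ℤ} (hn : n ≠ 0) (i : Fin 4) :
    limitEigenvalue γ Ω E z (n, i) = blockEigenvalue γ Ω E 0 i := by
  rw [limitEigenvalue, dimerSeq_of_ne z hn]

theorem finite_range_limitEigenvalue (γ Ω E : ℝ) (z : ℂ) :
    (Set.range (limitEigenvalue γ Ω E z)).Finite := by
  refine ((Set.finite_range (blockEigenvalue γ Ω E z)).union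
    (Set.finite_range (blockEigenvalue γ Ω E 0))).subset ?_
  rintro _ ⟨⟨n, i⟩, rfl⟩
  by_cases hn : n = 0
  · subst hn
    exact Or.inl ⟨i, (limitEigenvalue_zero γ Ω E z i).symm⟩
  · exact Or.inr ⟨i, (limitEigenvalue_of_ne γ Ω E z hn i).symm⟩

theorem gaugeMode_ne_zero {U : Seq} (h : U 0 ≠ 0) : gaugeMode U (star U) ≠ 0 := by
  intro h0
  have h1 : gaugeMode U (star U) 0 0 = 0 := by rw [h0]; rfl
  rw [gaugeMode_star_apply] at h1
  exact h h1

/-- A breather with the spectral picture of its anticontinuum limit. -/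
theorem exists_breather_with_limit_spectrum {γ Ω E : ℝ} {z : ℂ} (hz0 : z ≠ 0)
    (hz : onsite γ Ω E z = 0)
    (hnd : ‖symmEntry γ E z‖ ^ 2 ≠ (Ω + 12 * ‖z‖ ^ 2) ^ 2)
    (hnd0 : ‖symmEntry γ E 0‖ ^ 2 ≠ Ω ^ 2) {o : ℤ × Fin 4}
    (ho : ∀ k, limitEigenvalue γ Ω E z k = 0 ↔ k = o) :
    ∃ C₀ > 0, ∃ ε₀ > 0, ∀ ε : ℝ, 0 < ε → ε < ε₀ → ∃ U : Seq,
      IsBreather γ Ω E ε U ∧ NearDimer z C₀ ε U ∧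
      (∀ U' : Seq, IsBreather γ Ω E ε U' → NearDimer z C₀ ε U' → U' = U) ∧
      (Module.finrank ℂ (LinearMap.ker (hessian γ Ω E ε U).toLinearMap) = 1 ∧
        LinearMap.ker (hessian γ Ω E ε U).toLinearMap =
          Submodule.span ℂ {gaugeMode U (star U)}) ∧
      ({k | 0 < limitEigenvalue γ Ω E z k}.Infinite →
        ¬ FiniteDimensional ℂ (positiveSpectralSubspace (hessian γ Ω E ε U))) ∧
      ({k | limitEigenvalue γ Ω E z k < 0}.Infinite →
        ¬ FiniteDimensional ℂ (negativeSpectralSubspace (hessian γ Ω E ε U))) ∧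
      (∀ J : Finset (ℤ × Fin 4), (∀ k, k ∈ J ↔ 0 < limitEigenvalue γ Ω E z k) →
        Set.InjOn (limitEigenvalue γ Ω E z) J →
        HasSimplePositiveSpectrum (hessian γ Ω E ε U) J.card) := by
  obtain ⟨b, hb⟩ := exists_blockOp_eigenbasis γ Ω E (dimerSeq z)
  obtain ⟨δ, hδ, hspec⟩ := ker_and_spectrum_of_diagonal b
    (blockOp_isSelfAdjoint γ Ω E (dimerSeq z)) (l := limitEigenvalue γ Ω E z) hb
    (finite_range_limitEigenvalue γ Ω E z) ((ho o).2 rfl) (fun k hk => (ho k).1 hk)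
  obtain ⟨r, hr, hclose⟩ := norm_hessian_sub_le γ Ω E z hδ
  obtain ⟨C₀, hC₀, hex⟩ := exists_unique_breather hz0 hz hnd hnd0
  have hzn : 0 < ‖z‖ := norm_pos_iff.2 hz0
  -- The radius `‖z‖ / 2` keeps `U 0`, hence the gauge mode, nonzero.
  obtain ⟨ε₁, hε₁, hU⟩ := hex (min r (‖z‖ / 2)) (by positivity)
  refine ⟨C₀, hC₀, min ε₁ r, by positivity, fun ε hε hεs => ?_⟩
  obtain ⟨U, hbr, hnear, huniq, hclU⟩ := hU ε hε (hεs.trans_le (min_le_left _ _))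
  have hU0 : U 0 ≠ 0 := fun h0 => by
    have h1 := (lp.norm_apply_le_norm (by norm_num) (U - dimerSeq z) 0).trans
      (hclU.trans (min_le_right _ _))
    rw [lp.coeFn_sub, Pi.sub_apply, h0, dimerSeq_zero, zero_sub, norm_neg] at h1
    linarith
  exact ⟨U, hbr, hnear, huniq, hspec _ (hessian_isSelfAdjoint γ Ω E ε U)
    (hclose ε hε (hεs.le.trans (min_le_right _ _)) U (hclU.trans (min_le_left _ _)))
    _ (gaugeMode_ne_zero hU0) (hessian_gaugeMode hbr)⟩

end PTBreather

/-! ### Signs of the limit eigenvalues and conclusion -/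

theorem mainTheorem4 (γ Ω E A θ : ℝ) (hγ : γ ≠ 0) (hγΩ : |γ| < |Ω|) (hΩ : Ω ≠ -2 * |γ|)
    (hE : E ≠ PTBreather.E0 γ Ω) (hE' : E ≠ -PTBreather.E0 γ Ω)
    (hbranch : PTBreather.OnBranchA γ Ω E A θ ∨ PTBreather.OnBranchB γ Ω E A θ ∨
      PTBreather.OnBranchC γ Ω E A θ) :
    ∃ C₀ > 0, ∃ ε₀ > 0, ∀ ε : ℝ, 0 < ε → ε < ε₀ →
      ∃ U : PTBreather.Seq,
        PTBreather.IsBreather γ Ω E ε U ∧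
        PTBreather.NearDimer (PTBreather.polar A θ) C₀ ε U ∧
        (∀ U' : PTBreather.Seq, PTBreather.IsBreather γ Ω E ε U' →
          PTBreather.NearDimer (PTBreather.polar A θ) C₀ ε U' → U' = U) ∧
        (Module.finrank ℂ (LinearMap.ker (PTBreather.hessian γ Ω E ε U).toLinearMap) = 1 ∧
          LinearMap.ker (PTBreather.hessian γ Ω E ε U).toLinearMap =
            Submodule.span ℂ {PTBreather.gaugeMode U (star U)}) ∧
        (PTBreather.E0 γ Ω < |E| →
          ¬ FiniteDimensional ℂ
              (PTBreather.positiveSpectralSubspace (PTBreather.hessian γ Ω E ε U)) ∧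
          ¬ FiniteDimensional ℂ
              (PTBreather.negativeSpectralSubspace (PTBreather.hessian γ Ω E ε U))) ∧
        (|E| < PTBreather.E0 γ Ω → Ω < -|γ| →
          ¬ FiniteDimensional ℂ
              (PTBreather.negativeSpectralSubspace (PTBreather.hessian γ Ω E ε U)) ∧
          (PTBreather.OnBranchB γ Ω E A θ →
            PTBreather.HasSimplePositiveSpectrum (PTBreather.hessian γ Ω E ε U) 3) ∧
          (PTBreather.OnBranchC γ Ω E A θ →
            PTBreather.HasSimplePositiveSpectrum (PTBreather.hessian γ Ω E ε U) 1)) := by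
  open PTBreather in
  have hA : 0 < A := by rcases hbranch with h | h | h <;> exact h.2.1
  have hd : IsDimer γ Ω E (polar A θ) := by
    rcases hbranch with h | h | h
    exacts [h.2.2, h.2.2.2, h.2.2.2]
  have hzn := norm_polar hA θ
  have hz0 : polar A θ ≠ 0 := norm_pos_iff.1 (by rw [hzn]; exact hA)
  have hE0sq := E0_sq hγΩ
  have hE0nn : 0 ≤ E0 γ Ω := Real.sqrt_nonneg _
  obtain ⟨ρ, hρ0, hρ2, hρ, hev0⟩ := blockEigenvalue_zero γ Ω E
  have hρΩ : ρ ^ 2 ≠ Ω ^ 2 := fun h => by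
    have h1 : E ^ 2 = E0 γ Ω ^ 2 := by linarith
    rcases sq_eq_sq_iff_eq_or_eq_neg.1 h1 with h2 | h2
    exacts [hE h2, hE' h2]
  have hρp : Ω + ρ ≠ 0 := fun h => hρΩ (by rw [eq_neg_of_add_eq_zero_right h, neg_sq])
  have hρm : Ω - ρ ≠ 0 := fun h => hρΩ (by rw [sub_eq_zero.1 h])
  have hne0 : ∀ n : ℤ, n ≠ 0 → ∀ i, limitEigenvalue γ Ω E (polar A θ) (n, i) ≠ 0 := by
    intro n hn i
    rw [limitEigenvalue_of_ne γ Ω E _ hn, hev0]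
    fin_cases i <;> simpa
  have hcases : (0 < blockEigenvalue γ Ω E (polar A θ) 0 ∧
      blockEigenvalue γ Ω E (polar A θ) 1 ≠ 0) ∧
      ∃ j : Fin 4, ∀ i, blockEigenvalue γ Ω E (polar A θ) i = 0 ↔ i = j := by
    have hupper : 0 < Ω + 4 * A ^ 2 → 0 < 2 * (Ω + 4 * A ^ 2) ^ 3 - Ω * γ ^ 2 → _ := fun h₁ h₂ =>
      pos_pos_pos_zero_of_upper_branch hγ hA hd h₁ h₂
    rcases hbranch with h | h | h
    · obtain ⟨h0, h1, h2, h3⟩ := hupper (upper_branch_of_onBranchA h).1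
        (upper_branch_of_onBranchA h).2
      refine ⟨⟨h0, h1.ne'⟩, 3, fun i => ?_⟩
      fin_cases i <;> simp [h0.ne', h1.ne', h2.ne', h3]
    · obtain ⟨h0, h1, h2, h3⟩ := hupper (upper_branch_of_onBranchB hγ hγΩ h).2.1
        (upper_branch_of_onBranchB hγ hγΩ h).2.2
      refine ⟨⟨h0, h1.ne'⟩, 3, fun i => ?_⟩
      fin_cases i <;> simp [h0.ne', h1.ne', h2.ne', h3]
    · obtain ⟨h0, h1, h2, h3⟩ := pos_neg_zero_neg_of_onBranchC hγ hΩ h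
      refine ⟨⟨h0, h1.ne⟩, 2, fun i => ?_⟩
      fin_cases i <;> simp [h0.ne', h1.ne, h2, h3.ne]
  obtain ⟨⟨hpos0, hne1⟩, j, hj⟩ := hcases
  have ho : ∀ k, limitEigenvalue γ Ω E (polar A θ) k = 0 ↔ k = (0, j) := by
    rintro ⟨n, i⟩
    by_cases hn : n = 0
    · subst hn
      rw [limitEigenvalue_zero, hj]
      simp
    · simp [hne0 n hn i, hn]
  have hnd : ‖symmEntry γ E (polar A θ)‖ ^ 2 ≠ (Ω + 12 * ‖polar A θ‖ ^ 2) ^ 2 := fun h => by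
    rcases sq_eq_sq_iff_eq_or_eq_neg.1 h with h1 | h1
    · exact hne1 (by simp [blockEigenvalue, h1])
    · exact hpos0.ne' (by simp [blockEigenvalue, h1])
  obtain ⟨C₀, hC₀, ε₀, hε₀, hmain⟩ := exists_breather_with_limit_spectrum hz0
    (onsite_eq_zero_of_isDimer hd) hnd (by rwa [hρ]) ho
  refine ⟨C₀, hC₀, ε₀, hε₀, fun ε hε hεs => ?_⟩
  obtain ⟨U, hbr, hnear, huniq, hker, hposinf, hneginf, hcount⟩ := hmain ε hε hεs
  refine ⟨U, hbr, hnear, huniq, hker, fun hEE => ?_, fun hEE hΩneg => ?_⟩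
  -- Every empty node then carries both signs, since `Ω - ρ < 0 < Ω + ρ`.
  · have h1 : |Ω| < ρ := by
      refine abs_lt_of_sq_lt_sq ?_ hρ0
      have := pow_lt_pow_left₀ hEE hE0nn two_ne_zero
      rw [sq_abs] at this
      linarith
    have h2 := abs_lt.1 h1
    refine ⟨hposinf (infinite_preimage_of_ne_zero _ 0 fun n hn => ?_),
      hneginf (infinite_preimage_of_ne_zero _ 1 fun n hn => ?_)⟩
    all_goals
      rw [limitEigenvalue_of_ne γ Ω E _ hn, hev0]
      simp only [Matrix.cons_val]
      linarith
  -- All empty nodes are now negative, so positive eigenvalues can come only from node `0`.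
  · have h1 : ρ < -Ω := by
      refine (abs_lt_of_sq_lt_sq' ?_ (by linarith [abs_nonneg γ])).2
      have := pow_lt_pow_left₀ hEE (abs_nonneg E) two_ne_zero
      rw [sq_abs] at this
      linarith [neg_sq Ω]
    have hneg : ∀ n : ℤ, n ≠ 0 → ∀ i, limitEigenvalue γ Ω E (polar A θ) (n, i) < 0 := by
      intro n hn i
      rw [limitEigenvalue_of_ne γ Ω E _ hn, hev0]
      fin_cases i <;> simp <;> linarith
    refine ⟨hneginf (infinite_preimage_of_ne_zero _ 0 fun n hn => hneg n hn 0), fun hB => ?_,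
      fun hC => ?_⟩
    · obtain ⟨hb1, hb2⟩ := (upper_branch_of_onBranchB hγ hγΩ hB).2
      obtain ⟨h0, h1, h2, h3⟩ := pos_pos_pos_zero_of_upper_branch hγ hA hd hb1 hb2
      obtain ⟨d01, d02, d12⟩ := distinct_of_onBranchB hγ hγΩ hB
      refine hcount {(0, 0), (0, 1), (0, 2)} ?_ ?_
      · rintro ⟨n, i⟩
        by_cases hn : n = 0
        · subst hn
          rw [limitEigenvalue_zero]
          fin_cases i <;> simp [h0, h1, h2, h3]
        · simp [hn, (hneg n hn i).le]
      · rintro ⟨n, i⟩ hk ⟨m, j⟩ hk' heq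
        simp only [Finset.coe_insert, Finset.coe_singleton, Set.mem_insert_iff, Prod.mk.injEq,
          Set.mem_singleton_iff] at hk hk'
        rcases hk with ⟨rfl, rfl⟩ | ⟨rfl, rfl⟩ | ⟨rfl, rfl⟩ <;>
          rcases hk' with ⟨rfl, rfl⟩ | ⟨rfl, rfl⟩ | ⟨rfl, rfl⟩ <;>
          simp only [limitEigenvalue_zero] at heq <;>
          first
            | rfl
            | exact absurd heq d01
            | exact absurd heq d02
            | exact absurd heq d12
            | exact absurd heq.symm d01
            | exact absurd heq.symm d02
            | exact absurd heq.symm d12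
    · obtain ⟨h0, h1, h2, h3⟩ := pos_neg_zero_neg_of_onBranchC hγ hΩ hC
      refine hcount {(0, 0)} ?_ (by simp)
      rintro ⟨n, i⟩
      by_cases hn : n = 0
      · subst hn
        rw [limitEigenvalue_zero]
        fin_cases i <;> simp [h0, h1.le, h2, h3.le]
      · simp [hn, (hneg n hn i).le]
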